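/- **Setting.** Let $d\ge 1$, $m\ge 0$ be integers and let $b\ge 2$ be an even integer. For $\ell\ge 0$ put $t^\ell_i=i/2^\ell$ ($i\in\mathbb Z$); the level-$\ell$ cells are the cubes $\prod_{j=1}^d[t^\ell_{i_j},t^\ell_{i_j+1}]$, $\overline i\in\mathbb Z^d$, and $P^\ell_{\overline i,m}(\overline x)=\prod_{j=1}^d N^\ell_{i_j,m}(x_j)$ are the tensor product B-splines, where $N^\ell_{i,m}$ is the B-spline of degree $m$ on the knots $(t^\ell_i)_{i\in\mathbb Z}$ (Cox–de Boor recursion starting from the indicator functions $N^\ell_{i,0}$ of $[t^\ell_i,t^\ell_{i+1})$), with support $\mathrm{supp}\,P^\ell_{\overline i,m}=\prod_j(t^\ell_{i_j},t^\ell_{i_j+m+1})$. A *hierarchical mesh* $\mathcal T$ is given by domains $\Omega^0=\mathbb R^d\supseteq\Omega^1\supseteq\dots\supseteq\Omega^{N-1}\ne\varnothing$, $\Omega^N=\varnothing$ ($N\ge 1$), where $\Omega^{\ell}$ is a union of level-$(\ell-1)$ cells for $1\le\ell\le N-1$. Its cells are the level-$\ell$ cells contained in $\Omega^\ell\setminus\mathring\Omega^{\ell+1}$,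 $0\le\ell\le N-1$. $\mathcal S_m(\mathcal T)$ is the space of functions $f:\mathbb R^d\to\mathbb R$ of class $C^{m-1}$ (no condition if $m=0$) which on each cell of $\mathcal T$ (taken half-open, $\prod_j[t^\ell_{i_j},t^\ell_{i_j+1})$, if $m=0$) are polynomials of degree at most $m$ in each variable. Put $\mathcal M^{\ell}=\mathbb R^d\setminus\mathring\Omega^{\ell+1}$ for $-1\le \ell\le N-1$ and let $\mathcal K=\mathcal K^0\cup\dots\cup\mathcal K^{N-1}$, where $\mathcal K^\ell$ is the set of those $\beta=P^\ell_{\overline i,m}$ with $\mathrm{supp}\,\beta\cap\mathcal M^{\ell-1}=\varnothing$ and $\mathrm{supp}\,\beta\cap\mathcal M^{\ell}\ne\varnothing$. For $z\in\mathbb Z[1/b]$ write $|z|=\sum_{i=1}^k\alpha_ib^{i-1}+\sum_{i=1}^k\beta_ib^{-i}$ with digits $\alpha_i,\beta_i\in\{0,\dots,b-1\}$, where $k=0$ or $(\alpha_k,\beta_k)\ne(0,0)$, and let $(z)_b$ be the word $\binom{s}{s}\binom{\alpha_1}{\beta_1}\cdots\binom{\alpha_k}{\beta_k}$ with $s=0$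 if $z\ge0$ and $s=1$ if $z<0$. A $k$-ary relation on words is *FA-recognizable* if the language of convolutions $w_1\otimes\dots\otimes w_k$ of its elements (the words are read synchronously, shorter ones being padded at the end by a new symbol) is regular. For a cell $c$ with barycentre $\overline z_c=(z_1,\dots,z_d)$ let $(\overline z_c)_b$ be the tuple $((z_1)_b,\dots,(z_d)_b)$. The mesh $\mathcal T$ is *regular* if for each $\ell=1,\dots,N-1$ the relation $\{(\overline z_c)_b : c\subseteq\Omega^\ell \text{ a level-}(\ell-1)\text{ cell}\}$ is FA-recognizable. To $\beta=P^\ell_{\overline i,m}$ associate the level-$\ell$ cell $c_\beta$ with lower left corner $(t^\ell_{i_j+\lfloor (m+1)/2\rfloor})_{j}$. For a regular mesh $\mathcal T$, a function $f\in\mathcal S_m(\mathcal T)$ is a *regular spline in $\mathcal S_m(\mathcal T)$* if $f=\sum_{\beta\in\mathcal K}\lambda_\beta\beta$ for some coefficients $\lambda_\beta\in\mathbb Z[1/b]$ such that the $(d+1)$-ary relation $S_f=\{((\overline z_{c_\beta})_b,(\lambda_\beta)_b):\beta\in\mathcal K\}$ is FA-recognizable. **Theorem.** Let $\mathcal T$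 be a regular hierarchical mesh given by $\Omega^0=\mathbb R^d\supseteq\Omega^1\supseteq\dots\supseteq\Omega^{N-1}\neq\varnothing$, and let $\mathcal T'$ be a hierarchical mesh given by $\Omega^0\supseteq\Omega^1\supseteq\dots\supseteq\Omega^{N-1}\supseteq\Omega^N\ne\varnothing$, where $\Omega^N$ is a union of level-$(N-1)$ cells, and assume that $\mathcal T'$ is also regular. If $f$ is a regular spline in $\mathcal S_m(\mathcal T)$, then $f$ is a regular spline in $\mathcal S_m(\mathcal T')$. -/

import Mathlib

noncomputable section

/-! ### Grids, cells and tensor product B-splines -/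

/-- The knot `t^ℓ_i = i / 2 ^ ℓ`. -/
def knot (ℓ : ℕ) (i : ℤ) : ℝ := (i : ℝ) / 2 ^ ℓ

/-- The closed cell `∏_j [t^ℓ_{i_j}, t^ℓ_{i_j + 1}]` of the level `ℓ` grid. -/
def gridCell {d : ℕ} (ℓ : ℕ) (i : Fin d → ℤ) : Set (Fin d → ℝ) :=
  {x | ∀ j, knot ℓ (i j) ≤ x j ∧ x j ≤ knot ℓ (i j + 1)}

/-- The half-open cell `∏_j [t^ℓ_{i_j}, t^ℓ_{i_j + 1})` of the level `ℓ` grid. -/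
def gridCellHalfOpen {d : ℕ} (ℓ : ℕ) (i : Fin d → ℤ) : Set (Fin d → ℝ) :=
  {x | ∀ j, knot ℓ (i j) ≤ x j ∧ x j < knot ℓ (i j + 1)}

/-- The barycentre of the cell `gridCell ℓ i`. -/
def barycentre {d : ℕ} (ℓ : ℕ) (i : Fin d → ℤ) : Fin d → ℝ :=
  fun j => (knot ℓ (i j) + knot ℓ (i j + 1)) / 2

/-- The univariate B-spline `N^ℓ_{i,m}` of degree `m` (Cox–de Boor recursion);
`bspline ℓ m i t` is `N^ℓ_{i,m}(t)`. -/
def bspline (ℓ : ℕ) : ℕ → ℤ → ℝ → ℝ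
  | 0, i, t => if knot ℓ i ≤ t ∧ t < knot ℓ (i + 1) then 1 else 0
  | j + 1, i, t =>
      (t - knot ℓ i) / (knot ℓ (i + (j + 1)) - knot ℓ i) * bspline ℓ j i t
        + (knot ℓ (i + (j + 2)) - t) / (knot ℓ (i + (j + 2)) - knot ℓ (i + 1))
            * bspline ℓ j (i + 1) t

/-- The tensor product B-spline `P^ℓ_{i,m}`. -/
def tensorBspline {d : ℕ} (m ℓ : ℕ) (i : Fin d → ℤ) (x : Fin d → ℝ) : ℝ :=
  ∏ j, bspline ℓ m (i j) (x j)

/-- The support of `P^ℓ_{i,m}`, the open box `∏_j (t^ℓ_{i_j}, t^ℓ_{i_j + m + 1})`.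
For `m ≥ 1` this is exactly the set where `P^ℓ_{i,m}` does not vanish; for `m = 0` it is the
interior of that set. -/
def bsplineSupport {d : ℕ} (m ℓ : ℕ) (i : Fin d → ℤ) : Set (Fin d → ℝ) :=
  {x | ∀ j, knot ℓ (i j) < x j ∧ x j < knot ℓ (i j + (m + 1))}

/-- The index of the cell `c_β` associated with `β = P^ℓ_{i,m}`: the central cell of the closure
of `supp β` if `m + 1` is odd, and the cell whose lower left corner is the central vertex of
`supp β` if `m + 1` is even. Both are given by the same formula, with `(m + 1) / 2` rounded
down. -/
def assocCell {d : ℕ} (m : ℕ) (i : Fin d → ℤ) : Fin d → ℤ :=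
  fun j => i j + ((m + 1) / 2 : ℕ)

/-! ### Hierarchical meshes and splines -/

/-- A `d`-dimensional hierarchical mesh: a nested sequence of domains
`ℝ^d = Ω 0 ⊇ Ω 1 ⊇ ⋯ ⊇ Ω (N - 1) ≠ ∅` followed by `Ω N = ∅` (and `Ω ℓ = ∅` for `ℓ ≥ N`), where
`Ω (ℓ + 1)` is a union of cells of the level `ℓ` grid. -/
structure HierarchicalMesh (d : ℕ) where
  /-- the number of levels -/
  N : ℕ
  /-- the domains -/
  Ω : ℕ → Set (Fin d → ℝ)
  N_pos : 0 < N
  Ω_zero : Ω 0 = Set.univ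
  Ω_succ_subset : ∀ ℓ, Ω (ℓ + 1) ⊆ Ω ℓ
  Ω_last_nonempty : (Ω (N - 1)).Nonempty
  Ω_eq_empty : ∀ ℓ, N ≤ ℓ → Ω ℓ = ∅
  Ω_succ_eq_iUnion : ∀ ℓ, ∃ M : Set (Fin d → ℤ), Ω (ℓ + 1) = ⋃ i ∈ M, gridCell ℓ i

namespace HierarchicalMesh

variable {d : ℕ}

/-- `T.cells` is the set of all `(ℓ, i)` such that `gridCell ℓ i` is a `d`-dimensional cell of the
mesh, i.e. a level `ℓ` cell contained in `Ω ℓ` minus the interior of `Ω (ℓ + 1)`. -/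
def cells (T : HierarchicalMesh d) : Set (ℕ × (Fin d → ℤ)) :=
  {p | p.1 < T.N ∧ gridCell p.1 p.2 ⊆ T.Ω p.1 \ interior (T.Ω (p.1 + 1))}

/-- The spline space `S_m(T)`: functions of class `C^{m-1}` (no condition if `m = 0`) that are
polynomials of degree at most `m` in each variable on every cell of the mesh.
If `m ≥ 1` the functions are continuous, so it makes no difference whether the cells are taken
closed or half-open. If `m = 0` the cells have to be half-open: closed cells overlap, and only
the constant functions would remain. -/
def splineSpace (T : HierarchicalMesh d) (m : ℕ) : Set ((Fin d → ℝ) → ℝ) :=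
  {f | (∀ k : ℕ, k + 1 ≤ m → ContDiff ℝ (k : WithTop ℕ∞) f) ∧
    ∀ p ∈ T.cells, ∃ q : MvPolynomial (Fin d) ℝ, (∀ j, q.degreeOf j ≤ m) ∧
      ∀ x ∈ gridCellHalfOpen p.1 p.2, f x = MvPolynomial.eval x q}

/-- Kraft's selection mechanism: `(ℓ, i) ∈ T.kraft m` iff `P^ℓ_{i,m}` belongs to `K^ℓ`, i.e. its
support is disjoint from `M^{ℓ-1}` and meets `M^ℓ`, where `M^ℓ` is the complement of the interior
of `Ω (ℓ + 1)` (so that `M^{-1} = ∅`). -/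
def kraft (T : HierarchicalMesh d) (m : ℕ) : Set (ℕ × (Fin d → ℤ)) :=
  {p | p.1 < T.N ∧ bsplineSupport m p.1 p.2 ∩ (interior (T.Ω p.1))ᶜ = ∅ ∧
    (bsplineSupport m p.1 p.2 ∩ (interior (T.Ω (p.1 + 1)))ᶜ).Nonempty}

/-- `T'` refines `T` by one more level: the domains `Ω 0, …, Ω (N - 1)` of `T` are kept and one
nonempty domain `Ω N` is added. -/
def IsRefinementOf (T' T : HierarchicalMesh d) : Prop :=
  T'.N = T.N + 1 ∧ ∀ ℓ < T.N, T'.Ω ℓ = T.Ω ℓ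

end HierarchicalMesh

/-! ### Synchronous multitape finite automata -/

/-- The convolution `w_1 ⊗ ⋯ ⊗ w_k` of `k` words; `none` is the padding symbol. -/
def convolution {A : Type} {k : ℕ} (w : Fin k → List A) : List (Fin k → Option A) :=
  (List.range (Finset.univ.sup fun j => (w j).length)).map fun n j => (w j)[n]?

/-- A `k`-ary relation on words is FA-recognizable if the language of all convolutions of its
elements is regular. (The column consisting of padding symbols only never occurs in a
convolution, so it does not matter that it is kept in the alphabet.) -/
def FARecognizable {A : Type} {k : ℕ} (R : Set (Fin k → List A)) : Prop :=
  Language.IsRegular (convolution '' R : Language (Fin k → Option A))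

/-! ### The numbers `ℤ[1/b]` and their representation by words -/

/-- The real numbers in `ℤ[1/b]`. -/
def zInv (b : ℕ) : Set ℝ := {x | ∃ (s : ℤ) (n : ℕ), x = (s : ℝ) / (b : ℝ) ^ n}

/-- The alphabet `Σ_b` of pairs `(α, β)` of base `b` digits. -/
abbrev DigitPair (b : ℕ) : Type := Fin b × Fin b

/-- The number `∑_{n=1}^k α_n b^{n-1} + ∑_{n=1}^k β_n b^{-n}` given by the word
`(α_1, β_1) ⋯ (α_k, β_k)`. -/
def digitValue {b : ℕ} (u : List (DigitPair b)) : ℝ :=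
  ∑ n : Fin u.length,
    (((u.get n).1 : ℕ) * (b : ℝ) ^ (n : ℕ) + ((u.get n).2 : ℕ) / (b : ℝ) ^ ((n : ℕ) + 1))

/-- `IsCode b z w` says that `w` is the word `(z)_b` representing `z ∈ ℤ[1/b]`: it consists of
a sign symbol, `(0, 0)` if `z ≥ 0` and `(1, 1)` if `z < 0`, followed by the word
`(α_1, β_1) ⋯ (α_k, β_k)` of the base `b` digits of `|z|`, where `k = 0` (the case `z = 0`) or
`(α_k, β_k) ≠ (0, 0)`. -/
def IsCode (b : ℕ) (z : ℝ) (w : List (DigitPair b)) : Prop :=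
  ∃ (s : DigitPair b) (u : List (DigitPair b)), w = s :: u ∧
    (∀ e ∈ u.getLast?, (e.1 : ℕ) ≠ 0 ∨ (e.2 : ℕ) ≠ 0) ∧
    digitValue u = |z| ∧
    ((0 ≤ z ∧ (s.1 : ℕ) = 0 ∧ (s.2 : ℕ) = 0) ∨ (z < 0 ∧ (s.1 : ℕ) = 1 ∧ (s.2 : ℕ) = 1))

/-! ### Regular meshes and regular splines -/

namespace HierarchicalMesh

variable {d : ℕ}

/-- For `ℓ ≥ 1`, the `d`-ary relation consisting of the codes of the barycentres of those cells of
the level `ℓ - 1` grid which are contained in `Ω ℓ`. -/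
def domainRel (T : HierarchicalMesh d) (b ℓ : ℕ) : Set (Fin d → List (DigitPair b)) :=
  {w | ∃ i : Fin d → ℤ, gridCell (ℓ - 1) i ⊆ T.Ω ℓ ∧
    ∀ j, IsCode b (barycentre (ℓ - 1) i j) (w j)}

/-- A hierarchical mesh is regular (with respect to the base `b`) if for every
`ℓ = 1, …, N - 1` the language `L_ℓ` of convolutions of codes of barycentres is regular. -/
def IsRegular (T : HierarchicalMesh d) (b : ℕ) : Prop :=
  ∀ ℓ, 1 ≤ ℓ → ℓ < T.N → FARecognizable (T.domainRel b ℓ)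

/-- The relation `S_f` for the spline with coefficients `c`: all tuples formed by the code of the
barycentre of `c_β` (`d` words) and the code of the coefficient of `β` (the last word),
for `β ∈ K`. -/
def coeffRel (T : HierarchicalMesh d) (b m : ℕ) (c : T.kraft m → ℝ) :
    Set (Fin (d + 1) → List (DigitPair b)) :=
  {w | ∃ p : T.kraft m,
    (∀ j : Fin d, IsCode b (barycentre p.1.1 (assocCell m p.1.2) j) (w j.castSucc)) ∧
    IsCode b (c p) (w (Fin.last d))}

/-- `f` is a regular spline in `S_m(T)`: `f ∈ S_m(T)`, `f = ∑_{β ∈ K} c_β β` (at every point only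
finitely many terms are nonzero) with all `c_β ∈ ℤ[1/b]`, and the relation `S_f` is
FA-recognizable. -/
def IsRegularSpline (T : HierarchicalMesh d) (b m : ℕ) (f : (Fin d → ℝ) → ℝ) : Prop :=
  f ∈ T.splineSpace m ∧ ∃ c : T.kraft m → ℝ,
    (∀ x, HasSum (fun p : T.kraft m => c p * tensorBspline m p.1.1 p.1.2 x) (f x)) ∧
    (∀ p, c p ∈ zInv b) ∧
    FARecognizable (T.coeffRel b m c)

end HierarchicalMesh

end

noncomputable section

/-! ### Regular languages -/

namespace Language

variable {α β : Type*}

/-! Write `T.N = L + 1`. Passing from `T` to `T'` removes from 𝒦 exactly the level `L` B-splines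
supported in the interior of Ω^{L+1}, and adds the level `L + 1` B-splines supported there
(`IsRefinementOf.mem_kraft_iff`). By the two-scale relation `bspline_two_scale`, each removed
B-spline is a finite combination of added ones. Hence `f` is still represented if the new
coefficient at the level `L + 1` index n is 2^{-md} ∑_k ∏_j C(m+1, k_j) a((n - k)/2), where a gives
the removed coefficients, extended by zero.

It remains to see that finite automata can handle this formula. The argument is logical, in the
spirit of Büchi arithmetic: a set of real tuples is called automatic (`AutoSet`) if the words
representing its elements, with trailing zeros allowed, form a regular language for each choice of
signs. Automatic sets are closed under Boolean operations and projection (`AutoSet.exists_sumElim`),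
and integer linear equations define automatic sets (`AutoSet.linear`). So whatever is first-order
definable from automatic sets and linear equations, with quantifiers over ℤ[1/b], is automatic;
halving is allowed because b is even. `faRecognizable_codeRel_iff` identifies automatic sets with
FA-recognizable relations of codes. The coefficient relation for `T'` is definable in this sense
from the one for `T` and the domain relation of Ω^{L+1}. -/

theorem IsRegular.congr {L₁ L₂ : Language α} (h : L₁.IsRegular) (hL : ∀ x, x ∈ L₁ ↔ x ∈ L₂) :
    L₂.IsRegular := by
  rwa [← Language.ext hL]

/-- A member of a finite family of languages closed under left quotients by letters is regular. -/
theorem IsRegular.of_finite_family {F : Set (Language α)} (hF : F.Finite)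
    (hstep : ∀ L ∈ F, ∀ a, L.leftQuotient [a] ∈ F) {L : Language α} (hL : L ∈ F) :
    L.IsRegular := by
  -- Myhill–Nerode: by induction on the word, every left quotient of `L` stays in `F`.
  refine .of_finite_range_leftQuotient (hF.subset ?_)
  rintro _ ⟨x, rfl⟩
  induction x using List.reverseRecOn with
  | nil => simpa
  | append_singleton x a ih => rw [leftQuotient_append]; exact hstep _ ih a

/-- The version of `IsRegular.of_finite_family` for an indexed family. -/
theorem IsRegular.of_finite_index {ι : Type*} [Finite ι] (P : ι → Language α)
    (hstep : ∀ i a, ∃ j, (P i).leftQuotient [a] = P j) (i : ι) : (P i).IsRegular :=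
  .of_finite_family (Set.finite_range P)
    (by rintro _ ⟨i, rfl⟩ a; obtain ⟨j, hj⟩ := hstep i a; exact ⟨j, hj.symm⟩) ⟨i, rfl⟩

/-- A quotient by a nonempty word is a quotient of one of the finitely many languages assumed
regular. This allows the sign column at the start of a code to be treated separately. -/
theorem IsRegular.of_leftQuotient [Finite α] {L : Language α}
    (h : ∀ a, (L.leftQuotient [a]).IsRegular) : L.IsRegular := by
  refine .of_finite_range_leftQuotient (((Set.finite_singleton L).union
    (Set.finite_iUnion fun a => (h a).finite_range_leftQuotient)).subset ?_)
  rintro _ ⟨x, rfl⟩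
  cases x with
  | nil => simp
  | cons a x =>
    refine .inr (Set.mem_iUnion.2 ⟨a, x, ?_⟩)
    rw [← leftQuotient_append]; rfl

theorem isRegular_zero : (0 : Language α).IsRegular :=
  .of_finite_index (fun _ : Unit => 0) (fun _ _ => ⟨(), rfl⟩) ()

theorem IsRegular.inter {L₁ L₂ : Language α} (h₁ : L₁.IsRegular) (h₂ : L₂.IsRegular) :
    IsRegular {x | x ∈ L₁ ∧ x ∈ L₂} := h₁.inf h₂

theorem IsRegular.union {L₁ L₂ : Language α} (h₁ : L₁.IsRegular) (h₂ : L₂.IsRegular) :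
    IsRegular {x | x ∈ L₁ ∨ x ∈ L₂} := h₁.add h₂

theorem IsRegular.finite_biUnion {ι : Type*} {s : Set ι} (hs : s.Finite) {L : ι → Language α}
    (h : ∀ i ∈ s, (L i).IsRegular) : IsRegular {x | ∃ i ∈ s, x ∈ L i} := by
  induction s, hs using Set.Finite.induction_on with
  | empty => exact isRegular_zero.congr fun x => ⟨fun h => h.elim, fun ⟨_, h, _⟩ => h.elim⟩
  | insert _ _ ih =>
    exact ((h _ (Set.mem_insert ..)).union (ih fun i hi => h i (Set.mem_insert_of_mem _ hi))).congr
      fun x => (Set.exists_mem_insert (P := fun i => x ∈ L i)).symm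

theorem IsRegular.finite_iUnion {ι : Type*} [Finite ι] {L : ι → Language α}
    (h : ∀ i, (L i).IsRegular) : IsRegular {x | ∃ i, x ∈ L i} := by
  simpa using IsRegular.finite_biUnion Set.finite_univ fun i _ => h i

theorem IsRegular.comap_map {L : Language β} (h : L.IsRegular) (f : α → β) :
    IsRegular {x : List α | x.map f ∈ L} := by
  refine .of_finite_range_leftQuotient
    ((h.finite_range_leftQuotient.image fun K => {x : List α | x.map f ∈ K}).subset ?_)
  rintro _ ⟨x, rfl⟩
  refine ⟨_, ⟨x.map f, rfl⟩, ?_⟩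
  ext y
  change _ ++ _ ∈ L ↔ List.map f (_ ++ _) ∈ L
  rw [List.map_append]

/-- The projection of a regular language, where the projected words may be padded by `a₀`. -/
theorem IsRegular.map_padded {L : Language α} (h : L.IsRegular) (f : α → β) (b₀ : β) :
    IsRegular {x : List β | ∃ n, ∃ y ∈ L, y.map f = x ++ List.replicate n b₀} := by
  obtain ⟨σ, _, M, rfl⟩ := h
  -- Subset construction: `P S` is what is accepted from some state in `S`. The padding enters only
  -- the acceptance condition, so it does not affect the transitions.
  let P : Set σ → Language β := fun S =>
    {x | ∃ n, ∃ y : List α, (∃ q ∈ S, M.evalFrom q y ∈ M.accept) ∧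
      y.map f = x ++ List.replicate n b₀}
  have := IsRegular.of_finite_index P (fun S a => ⟨{q' | ∃ q ∈ S, ∃ a', f a' = a ∧
    M.step q a' = q'}, ?_⟩) {M.start}
  · exact this.congr fun x => ⟨fun ⟨n, y, ⟨_, rfl, h⟩, h'⟩ => ⟨n, y, h, h'⟩,
      fun ⟨n, y, h, h'⟩ => ⟨n, y, ⟨_, rfl, h⟩, h'⟩⟩
  · ext x
    constructor
    · rintro ⟨n, y, ⟨q, hq, hy⟩, hyx⟩
      cases y with
      | nil => simp at hyx
      | cons e y =>
        simp only [List.map_cons, List.cons_append, List.cons.injEq, List.nil_append] at hyx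
        exact ⟨n, y, ⟨_, ⟨q, hq, e, hyx.1, rfl⟩, hy⟩, hyx.2⟩
    · rintro ⟨n, y, ⟨_, ⟨q, hq, e, rfl, rfl⟩, hy⟩, hyx⟩
      exact ⟨n, e :: y, ⟨q, hq, hy⟩, by simp [hyx]⟩

end Language

/-! ### Convolutions -/

section Convolution

variable {A : Type} {k : ℕ}

theorem convolution_of_forall_nil {w : Fin k → List A} (h : ∀ j, w j = []) :
    convolution w = [] := by
  simp [convolution, h]

/-- This recursion replaces the definition by indices in all later arguments; `head?` produces the
padding symbol once a word is exhausted. -/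
theorem convolution_of_exists_ne_nil {w : Fin k → List A} (h : ∃ j, w j ≠ []) :
    convolution w = (fun j => (w j).head?) :: convolution fun j => (w j).tail := by
  have hs : (Finset.univ.sup fun j => (w j).length) =
      (Finset.univ.sup fun j => (w j).tail.length) + 1 := by
    apply le_antisymm
    · refine Finset.sup_le fun j _ => ?_
      have := Finset.le_sup (f := fun j => (w j).tail.length) (Finset.mem_univ j)
      simp only [List.length_tail] at this ⊢
      omega
    · obtain ⟨j₀, hj₀⟩ := h
      have h0 := Finset.le_sup (f := fun j => (w j).length) (Finset.mem_univ j₀)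
      have h1 := List.length_pos_iff.2 hj₀
      have : (Finset.univ.sup fun j => (w j).tail.length) ≤
          (Finset.univ.sup fun j => (w j).length) - 1 := by
        refine Finset.sup_le fun j _ => ?_
        have := Finset.le_sup (f := fun j => (w j).length) (Finset.mem_univ j)
        simp only [List.length_tail] at this ⊢
        omega
      omega
  unfold convolution
  rw [hs, List.range_succ_eq_map]
  rw [List.map_cons, List.map_map, List.cons.injEq]
  refine ⟨by ext1 j; cases w j <;> simp, List.map_congr_left fun n _ => ?_⟩
  ext1 j
  simp

theorem convolution_eq_nil_iff {w : Fin k → List A} : convolution w = [] ↔ ∀ j, w j = [] := by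
  refine ⟨fun h => ?_, convolution_of_forall_nil⟩
  by_contra! hw
  simp [convolution_of_exists_ne_nil hw] at h

theorem convolution_eq_cons_iff {w : Fin k → List A} {a v} :
    convolution w = a :: v ↔ (∃ j, w j ≠ []) ∧ (∀ j, (w j).head? = a j) ∧
      convolution (fun j => (w j).tail) = v := by
  constructor
  · intro h
    have hw : ∃ j, w j ≠ [] := by
      by_contra! hw
      simp [convolution_of_forall_nil hw] at h
    rw [convolution_of_exists_ne_nil hw, List.cons.injEq, funext_iff] at h
    exact ⟨hw, h⟩
  · rintro ⟨hw, ha, hv⟩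
    rw [convolution_of_exists_ne_nil hw, hv, funext ha]

theorem convolution_injective : Function.Injective (convolution : (Fin k → List A) → _) := by
  intro w w' h
  generalize hv : convolution w = v at h
  induction v generalizing w w' with
  | nil =>
    rw [eq_comm, convolution_eq_nil_iff] at h
    rw [convolution_eq_nil_iff] at hv
    exact funext fun j => (hv j).trans (h j).symm
  | cons a v ih =>
    rw [eq_comm, convolution_eq_cons_iff] at h
    rw [convolution_eq_cons_iff] at hv
    have := ih hv.2.2 h.2.2.symm
    ext1 j
    have h1 := (hv.2.1 j).trans (h.2.1 j).symm
    have h2 := congrFun this j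
    revert h1 h2
    cases w j <;> cases w' j <;> simp +contextual

/-- The convolutions of the tuples taken from a product of regular languages form a regular
language. -/
theorem isRegular_image_convolution {T : Fin k → Language A} (hT : ∀ j, (T j).IsRegular) :
    Language.IsRegular {v | ∃ w : Fin k → List A, convolution w = v ∧ ∀ j, w j ∈ T j} := by
  -- States of track `j`: the quotients of `T j`, together with `1` (the word has ended, only
  -- padding may follow) and `0` (failure).
  let F : Fin k → Set (Language A) := fun j => Set.range (T j).leftQuotient ∪ {0, 1}
  have hF : ∀ j, (F j).Finite := fun j =>
    (hT j).finite_range_leftQuotient.union (Set.toFinite _)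
  have hstep : ∀ j, ∀ L ∈ F j, ∀ a, L.leftQuotient [a] ∈ F j := by
    rintro j L (⟨x, rfl⟩ | rfl | rfl) a
    · exact .inl ⟨x ++ [a], Language.leftQuotient_append ..⟩
    · exact .inr (.inl rfl)
    · refine .inr (.inl ?_)
      ext x
      change a :: x = [] ↔ False
      simp
  -- The product of the track automata; `none` is the sink reached by the column of padding symbols
  -- only.
  let P : Option (∀ j, F j) → Language (Fin k → Option A) := fun Q => {v | ∃ Q' ∈ Q,
    ∃ w : Fin k → List A, convolution w = v ∧ ∀ j, w j ∈ (Q' j : Language A)}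
  have := fun j => (hF j).to_subtype
  refine (Language.IsRegular.of_finite_index P (fun Q a => ?_)
    (some fun j => ⟨T j, .inl ⟨[], rfl⟩⟩)).congr fun v => by simp [P]
  have hnone : ∀ v, v ∈ P none → False := by rintro v ⟨_, ⟨⟩, _⟩
  rcases Q with _ | Q
  · refine ⟨none, ?_⟩
    ext v
    exact iff_of_false (hnone _) (hnone _)
  by_cases ha : ∀ j, a j = none
  · refine ⟨none, ?_⟩
    ext v
    refine iff_of_false ?_ (hnone _)
    rintro ⟨Q', -, w, hw, -⟩
    obtain ⟨⟨j, hj⟩, h2, -⟩ := convolution_eq_cons_iff.1 hw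
    exact hj (List.head?_eq_none_iff.1 ((h2 j).trans (ha j)))
  · push Not at ha
    obtain ⟨j₀, hj₀⟩ := ha
    classical
    refine ⟨some fun j => match a j with
      | some e => ⟨(Q j : Language A).leftQuotient [e], hstep j _ (Q j).2 e⟩
      | none => if [] ∈ (Q j : Language A) then ⟨1, .inr (.inr rfl)⟩ else ⟨0, .inr (.inl rfl)⟩, ?_⟩
    ext v
    constructor
    · rintro ⟨_, ⟨⟩, w, hw, hQ⟩
      obtain ⟨-, h2, rfl⟩ := convolution_eq_cons_iff.1 hw
      refine ⟨_, rfl, _, rfl, fun j => ?_⟩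
      have h3 := h2 j
      have h4 := hQ j
      revert h3 h4
      cases w j with
      | nil =>
        intro h3 h4
        rw [← h3]
        simp only [List.head?_nil, h4, if_true]
        rfl
      | cons e y =>
        intro h3 h4
        rw [← h3]
        exact h4
    · rintro ⟨_, ⟨⟩, w, rfl, hQ⟩
      refine ⟨_, rfl, fun j => (a j).toList ++ w j, ?_, fun j => ?_⟩
      · have key : ∀ j, ((a j).toList ++ w j).head? = a j ∧
            ((a j).toList ++ w j).tail = w j := by
          intro j
          have h1 := hQ j
          cases haj : a j with
          | some e => simp
          | none =>
            simp only [haj] at h1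
            split_ifs at h1
            · have : w j = [] := h1
              simp [this]
            · exact h1.elim
        refine convolution_eq_cons_iff.2 ⟨⟨j₀, fun h => hj₀ ?_⟩, fun j => (key j).1, ?_⟩
        · rw [← (key j₀).1, h]; rfl
        · simp only [key]; rfl
      · have h1 := hQ j
        change (a j).toList ++ w j ∈ _
        cases haj : a j with
        | some e =>
          simp only [haj] at h1
          exact h1
        | none =>
          simp only [haj] at h1
          split_ifs at h1 with h2
          · have : w j = [] := h1
            simpa [this] using h2
          · exact h1.elim

end Convolution

/-! ### The values of digit words -/

section Digits

variable {b : ℕ}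

/-- The integer part of the number represented by a word of digit pairs. -/
def intPart : List (DigitPair b) → ℕ
  | [] => 0
  | e :: u => e.1 + b * intPart u

/-- The fractional part of the number represented by a word of digit pairs. -/
def fracPart : List (DigitPair b) → ℝ
  | [] => 0
  | e :: u => ((e.2 : ℕ) + fracPart u) / b

theorem digitValue_eq (u : List (DigitPair b)) : digitValue u = intPart u + fracPart u := by
  unfold digitValue
  rw [Finset.sum_add_distrib]
  congr 1
  · induction u with
    | nil => simp [intPart]
    | cons e u ih =>
      simp only [List.length_cons, Fin.sum_univ_succ, intPart]
      push_cast
      rw [← ih, Finset.mul_sum]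
      simp [pow_succ]
      exact Finset.sum_congr rfl fun _ _ => by ring
  · induction u with
    | nil => simp [fracPart]
    | cons e u ih =>
      simp only [List.length_cons, Fin.sum_univ_succ, fracPart]
      rw [← ih, add_div, Finset.sum_div]
      simp [pow_succ, div_div]

theorem fracPart_nonneg (u : List (DigitPair b)) : 0 ≤ fracPart u := by
  induction u with
  | nil => simp [fracPart]
  | cons e u ih => simp only [fracPart]; positivity

theorem fracPart_le_one (u : List (DigitPair b)) : fracPart u ≤ 1 := by
  induction u with
  | nil => simp [fracPart]
  | cons e u ih =>
    simp only [fracPart]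
    refine div_le_one_of_le₀ ?_ (by positivity)
    have : ((e.2 : ℕ) + 1 : ℝ) ≤ b := by exact_mod_cast e.2.2
    linarith

theorem digitValue_nonneg (u : List (DigitPair b)) : 0 ≤ digitValue u := by
  rw [digitValue_eq]
  have := fracPart_nonneg u
  positivity

theorem digitValue_nil : digitValue ([] : List (DigitPair b)) = 0 := by simp [digitValue]

theorem digitValue_append_replicate [NeZero b] (u : List (DigitPair b)) (n : ℕ) :
    digitValue (u ++ List.replicate n 0) = digitValue u := by
  have hz : ∀ n, intPart (List.replicate n (0 : DigitPair b)) = 0 ∧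
      fracPart (List.replicate n (0 : DigitPair b)) = 0 := by
    intro n
    induction n with
    | zero => simp [intPart, fracPart]
    | succ n ih => simp [List.replicate_succ, intPart, fracPart, ih]
  have hu : intPart (u ++ List.replicate n 0) = intPart u ∧
      fracPart (u ++ List.replicate n 0) = fracPart u := by
    induction u with
    | nil => simpa [intPart, fracPart] using hz n
    | cons e u ih => simp [intPart, fracPart, ih]
  rw [digitValue_eq, digitValue_eq, hu.1, hu.2]

/-! ### The ring `ℤ[1/b]` -/

theorem zInv_add (hb : 0 < b) {x y : ℝ} (hx : x ∈ zInv b) (hy : y ∈ zInv b) :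
    x + y ∈ zInv b := by
  obtain ⟨s, n, rfl⟩ := hx
  obtain ⟨t, k, rfl⟩ := hy
  refine ⟨s * b ^ k + t * b ^ n, n + k, ?_⟩
  have : (b : ℝ) ≠ 0 := by positivity
  push_cast
  field_simp
  ring

theorem zInv_mul {x y : ℝ} (hx : x ∈ zInv b) (hy : y ∈ zInv b) : x * y ∈ zInv b := by
  obtain ⟨s, n, rfl⟩ := hx
  obtain ⟨t, k, rfl⟩ := hy
  exact ⟨s * t, n + k, by push_cast; rw [pow_add, div_mul_div_comm]⟩

theorem intCast_mem_zInv (s : ℤ) : (s : ℝ) ∈ zInv b := ⟨s, 0, by simp⟩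

theorem div_base_mem_zInv {x : ℝ} (hx : x ∈ zInv b) : x / b ∈ zInv b := by
  obtain ⟨s, n, rfl⟩ := hx
  exact ⟨s, n + 1, by rw [pow_succ, div_div]⟩

/-- With b = 2a, halving is multiplication by a/b. This is what keeps barycentres, indices and knot
insertion weights inside ℤ[1/b]. -/
theorem div_two_pow_mem_zInv (hb : 0 < b) (hb2 : 2 ∣ b) {x : ℝ} (hx : x ∈ zInv b) (n : ℕ) :
    x / 2 ^ n ∈ zInv b := by
  obtain ⟨a, rfl⟩ := hb2
  have ha : (a : ℝ) ≠ 0 := by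
    have : 0 < a := by omega
    positivity
  induction n with
  | zero => simpa
  | succ n ih =>
    convert zInv_mul (intCast_mem_zInv a) (div_base_mem_zInv ih) using 1
    push_cast
    field_simp
    ring

theorem zInv_sum (hb : 0 < b) {ι : Type*} (s : Finset ι) {f : ι → ℝ}
    (hf : ∀ i ∈ s, f i ∈ zInv b) : ∑ i ∈ s, f i ∈ zInv b :=
  Finset.sum_induction _ (· ∈ zInv b) (fun _ _ => zInv_add hb)
    (by simpa using intCast_mem_zInv 0) hf

theorem fracPart_mem_zInv (hb : 0 < b) (u : List (DigitPair b)) : fracPart u ∈ zInv b := by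
  induction u with
  | nil => simpa [fracPart] using intCast_mem_zInv 0
  | cons e u ih =>
    exact div_base_mem_zInv (zInv_add hb (by simpa using intCast_mem_zInv (b := b) (e.2 : ℕ)) ih)

theorem digitValue_mem_zInv (hb : 0 < b) (u : List (DigitPair b)) : digitValue u ∈ zInv b := by
  rw [digitValue_eq]
  exact zInv_add hb (by simpa using intCast_mem_zInv (b := b) (intPart u)) (fracPart_mem_zInv hb u)

/-- Digits are produced outwards from the radix point: each letter takes the lowest remaining digit
of `q` and the highest remaining digit of `r`. After `n` letters `r` is used up, and the base case
finishes `q` with fractional digits 0. -/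
theorem exists_intPart_fracPart (hb : 1 < b) (n : ℕ) : ∀ q r : ℕ, r < b ^ n →
    ∃ u : List (DigitPair b), intPart u = q ∧ fracPart u = r / (b : ℝ) ^ n := by
  have hb0 : 0 < b := by omega
  have hb0' : (b : ℝ) ≠ 0 := by positivity
  induction n with
  | zero =>
    intro q
    induction q using Nat.strong_induction_on with
    | _ q ih =>
      intro r hr
      obtain rfl : r = 0 := by simpa using hr
      rcases Nat.eq_zero_or_pos q with rfl | hq
      · exact ⟨[], by simp [intPart, fracPart]⟩
      · obtain ⟨u, hu, hu'⟩ := ih (q / b) (Nat.div_lt_self hq hb) 0 hr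
        refine ⟨(⟨q % b, Nat.mod_lt _ hb0⟩, ⟨0, hb0⟩) :: u, ?_, ?_⟩
        · simp [intPart, hu, Nat.mod_add_div]
        · simp [fracPart, hu']
  | succ n ih =>
    intro q r hr
    obtain ⟨u, hu, hu'⟩ := ih (q / b) (r % b ^ n) (Nat.mod_lt _ (by positivity))
    refine ⟨(⟨q % b, Nat.mod_lt _ hb0⟩, ⟨r / b ^ n, Nat.div_lt_of_lt_mul (by
      rwa [pow_succ] at hr)⟩) :: u, ?_, ?_⟩
    · simp [intPart, hu, Nat.mod_add_div]
    · have : (r : ℝ) = (r % b ^ n : ℕ) + (b : ℝ) ^ n * (r / b ^ n : ℕ) := by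
        exact_mod_cast (Nat.mod_add_div r (b ^ n)).symm
      simp only [fracPart, hu']
      rw [this]
      field_simp
      ring

theorem exists_digitValue_eq_abs (hb : 1 < b) {x : ℝ} (hx : x ∈ zInv b) :
    ∃ u : List (DigitPair b), digitValue u = |x| := by
  obtain ⟨s, n, rfl⟩ := hx
  have hb0 : (0 : ℝ) < b := by positivity
  obtain ⟨u, hu, hu'⟩ := exists_intPart_fracPart hb n (s.natAbs / b ^ n) (s.natAbs % b ^ n)
    (Nat.mod_lt _ (by positivity))
  refine ⟨u, ?_⟩
  have : (s.natAbs : ℝ) = (s.natAbs % b ^ n : ℕ) + (b : ℝ) ^ n * (s.natAbs / b ^ n : ℕ) := by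
    exact_mod_cast (Nat.mod_add_div s.natAbs (b ^ n)).symm
  rw [digitValue_eq, hu, hu', abs_div, abs_of_pos (pow_pos hb0 n), ← Int.cast_abs,
    Int.abs_eq_natAbs, Int.cast_natCast, this]
  field_simp
  ring

end Digits

/-! ### Automatic sets -/

section SignedValue

variable {b : ℕ} {V W U : Type}

/-- The tuple of numbers given by a tuple `s` of signs and a word of tuples of digit pairs. -/
def signedValue (s : V → ℤˣ) (u : List (V → DigitPair b)) : V → ℝ :=
  fun v => ((s v : ℤ) : ℝ) * digitValue (u.map fun e => e v)

theorem signedValue_comp (s : V → ℤˣ) (u : List (V → DigitPair b)) (ρ : W → V) :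
    signedValue (s ∘ ρ) (u.map (· ∘ ρ)) = signedValue s u ∘ ρ := by
  ext w
  simp [signedValue, Function.comp_def]

theorem signedValue_mem_zInv (hb : 0 < b) (s : V → ℤˣ) (u : List (V → DigitPair b)) (v : V) :
    signedValue s u v ∈ zInv b :=
  zInv_mul (intCast_mem_zInv _) (digitValue_mem_zInv hb _)

theorem signedValue_append_replicate [NeZero b] (s : V → ℤˣ) (u : List (V → DigitPair b))
    (n : ℕ) : signedValue s (u ++ List.replicate n 0) = signedValue s u := by
  ext v
  simp [signedValue, List.map_append, digitValue_append_replicate]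

theorem exists_sign_mul_abs (x : ℝ) : ∃ s : ℤˣ, ((s : ℤ) : ℝ) * |x| = x := by
  rcases le_or_gt 0 x with h | h
  · exact ⟨1, by simp [abs_of_nonneg h]⟩
  · exact ⟨-1, by simp [abs_of_neg h]⟩

theorem map_range_getD {α : Type*} (w : List α) (a : α) {n : ℕ} (h : w.length ≤ n) :
    (List.range n).map (fun i => w[i]?.getD a) = w ++ List.replicate (n - w.length) a := by
  apply List.ext_getElem
  · simp; omega
  · intro i h1 h2
    simp only [List.getElem_map, List.getElem_range, List.getElem_append]
    split_ifs with h3 <;> simp [h3]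

/-- A word can be extended by further tracks with prescribed values. -/
theorem exists_map_inl_eq [NeZero b] (hb : 1 < b) [Finite U] (u : List (V → DigitPair b))
    {y : U → ℝ} (hy : ∀ v, y v ∈ zInv b) :
    ∃ (s : U → ℤˣ) (n : ℕ) (x : List (V ⊕ U → DigitPair b)),
      x.map (· ∘ Sum.inl) = u ++ List.replicate n 0 ∧
      signedValue s (x.map (· ∘ Sum.inr)) = y := by
  choose w hw using fun v => exists_digitValue_eq_abs hb (hy v)
  choose s hs using fun v => exists_sign_mul_abs (y v)
  obtain ⟨M, hM⟩ := (Set.finite_range fun v => (w v).length).bddAbove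
  have hM' : ∀ v, (w v).length ≤ M := fun v => hM ⟨v, rfl⟩
  let x : List (V ⊕ U → DigitPair b) := (List.range (u.length + M)).map fun i =>
    Sum.elim (u[i]?.getD 0) fun v => (w v)[i]?.getD 0
  refine ⟨s, u.length + M - u.length, x, ?_, ?_⟩
  · rw [← map_range_getD u 0 (by omega), List.map_map]
    exact List.map_congr_left fun i _ => rfl
  · ext v
    simp only [signedValue, x, List.map_map]
    have : (fun i : ℕ => (w v)[i]?.getD 0) = (fun e : U → DigitPair b => e v) ∘
        (fun e : V ⊕ U → DigitPair b => e ∘ Sum.inr) ∘ fun i : ℕ =>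
          Sum.elim (u[i]?.getD 0) fun v => (w v)[i]?.getD 0 := rfl
    rw [← this, map_range_getD _ _ ((hM' v).trans (by omega)), digitValue_append_replicate, hw, hs]

end SignedValue

/-- A set of tuples of numbers is automatic if, for each tuple of signs, the words of tuples of
digit pairs (possibly with redundant zeros at the end) representing its elements form a regular
language. -/
def AutoSet (b : ℕ) {V : Type} (X : Set (V → ℝ)) : Prop :=
  ∀ s : V → ℤˣ, Language.IsRegular {u : List (V → DigitPair b) | signedValue s u ∈ X}

namespace AutoSet

variable {b : ℕ} {V W U : Type}

/-- Every word represents some tuple, and membership depends on the value alone, so no restriction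
to canonical words has to be restored. -/
theorem compl {X : Set (V → ℝ)} (h : AutoSet b X) : AutoSet b Xᶜ := fun s => (h s).compl

theorem inter {X Y : Set (V → ℝ)} (hX : AutoSet b X) (hY : AutoSet b Y) : AutoSet b (X ∩ Y) :=
  fun s => (hX s).inter (hY s)

theorem union {X Y : Set (V → ℝ)} (hX : AutoSet b X) (hY : AutoSet b Y) : AutoSet b (X ∪ Y) :=
  fun s => (hX s).union (hY s)

theorem iUnion {ι : Type*} [Finite ι] {X : ι → Set (V → ℝ)} (h : ∀ i, AutoSet b (X i)) :
    AutoSet b (⋃ i, X i) :=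
  fun s => (Language.IsRegular.finite_iUnion fun i => h i s).congr fun u =>
    (Set.mem_iUnion (x := signedValue s u)).symm

theorem iInter {ι : Type*} [Finite ι] {X : ι → Set (V → ℝ)} (h : ∀ i, AutoSet b (X i)) :
    AutoSet b (⋂ i, X i) := by
  rw [← compl_compl (⋂ i, X i), Set.compl_iInter]
  exact (iUnion fun i => (h i).compl).compl

theorem comap_coord {X : Set (V → ℝ)} (h : AutoSet b X) (ρ : V → W) :
    AutoSet b {z : W → ℝ | z ∘ ρ ∈ X} := fun s => by
  refine ((h (s ∘ ρ)).comap_map (· ∘ ρ)).congr fun u => ?_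
  change signedValue _ _ ∈ X ↔ _ ∈ X
  rw [signedValue_comp]

/-- The tracks of the witness are erased. A witness may need more digits than `z`, whence the
projection with padding by zeros; its signs contribute a finite union. -/
theorem exists_sumElim [Finite U] (hb : 1 < b) {X : Set (V ⊕ U → ℝ)} (h : AutoSet b X) :
    AutoSet b {z : V → ℝ | ∃ y : U → ℝ, (∀ v, y v ∈ zInv b) ∧ Sum.elim z y ∈ X} := fun s => by
  have : NeZero b := ⟨by omega⟩
  refine (Language.IsRegular.finite_iUnion fun s' : U → ℤˣ =>
    (h (Sum.elim s s')).map_padded (· ∘ Sum.inl) 0).congr fun u => ?_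
  have key : ∀ (s' : U → ℤˣ) (x : List (V ⊕ U → DigitPair b)) (n : ℕ),
      x.map (· ∘ Sum.inl) = u ++ List.replicate n 0 → signedValue (Sum.elim s s') x =
        Sum.elim (signedValue s u) (signedValue s' (x.map (· ∘ Sum.inr))) := by
    intro s' x n hx
    rw [← signedValue_append_replicate s u n, ← hx]
    ext v
    rcases v with v | v <;> simp [signedValue, Function.comp_def]
  constructor
  · rintro ⟨s', n, x, hx, hxu⟩
    refine ⟨_, signedValue_mem_zInv (by omega) s' (x.map (· ∘ Sum.inr)), ?_⟩
    rw [← key s' x n hxu]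
    exact hx
  · rintro ⟨y, hy, hyX⟩
    obtain ⟨s', n, x, hx, rfl⟩ := exists_map_inl_eq hb u hy
    refine ⟨s', n, x, ?_, hx⟩
    change signedValue _ _ ∈ X
    rwa [key s' x n hx]

end AutoSet

/-! ### Linear equations define automatic sets -/

section Linear

variable {b : ℕ} {V : Type} [Fintype V]

/-- The linear form with coefficients `a`, applied to the integer parts of a word. -/
def linIntPart (a : V → ℤ) : List (V → DigitPair b) → ℤ
  | [] => 0
  | e :: u => ∑ v, a v * ((e v).1 : ℕ) + b * linIntPart a u

/-- The linear form with coefficients `a`, applied to the fractional parts of a word. -/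
def linFracPart (a : V → ℤ) : List (V → DigitPair b) → ℝ
  | [] => 0
  | e :: u => ((∑ v, a v * ((e v).2 : ℕ) : ℤ) + linFracPart a u) / b

theorem linIntPart_eq (a : V → ℤ) (u : List (V → DigitPair b)) :
    linIntPart a u = ∑ v, a v * (intPart (u.map fun e => e v) : ℤ) := by
  induction u with
  | nil => simp [linIntPart, intPart]
  | cons e u ih =>
    simp only [linIntPart, ih, List.map_cons, intPart, Finset.mul_sum, ← Finset.sum_add_distrib]
    refine Finset.sum_congr rfl fun v _ => ?_
    push_cast
    ring

theorem linFracPart_eq (a : V → ℤ) (u : List (V → DigitPair b)) :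
    linFracPart a u = ∑ v, a v * fracPart (u.map fun e => e v) := by
  induction u with
  | nil => simp [linFracPart, fracPart]
  | cons e u ih =>
    simp only [linFracPart, ih, List.map_cons, fracPart]
    push_cast
    rw [← Finset.sum_add_distrib, Finset.sum_div]
    refine Finset.sum_congr rfl fun v _ => ?_
    ring

theorem abs_linFracPart_le (a : V → ℤ) (u : List (V → DigitPair b)) :
    |linFracPart a u| ≤ (∑ v, |a v| : ℤ) := by
  rw [linFracPart_eq]
  push_cast
  refine (Finset.abs_sum_le_sum_abs _ _).trans (Finset.sum_le_sum fun v _ => ?_)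
  rw [abs_mul, abs_of_nonneg (fracPart_nonneg _)]
  exact mul_le_of_le_one_right (abs_nonneg _) (fracPart_le_one _)

theorem abs_sum_digit_le (a : V → ℤ) (e : V → Fin b) :
    |∑ v, a v * ((e v : ℕ) : ℤ)| ≤ (b - 1) * ∑ v, |a v| := by
  rw [Finset.mul_sum]
  refine (Finset.abs_sum_le_sum_abs _ _).trans (Finset.sum_le_sum fun v _ => ?_)
  rw [abs_mul, mul_comm]
  refine mul_le_mul_of_nonneg_right ?_ (abs_nonneg _)
  have := (e v).2
  rw [abs_of_nonneg (by positivity)]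
  omega

/-- Integer digits come lowest first, so the state is a carry: after a letter contributing t, the
target c becomes (c - t)/b, or the language is empty if b does not divide c - t. -/
theorem isRegular_linIntPart_eq (hb : 0 < b) (a : V → ℤ) (c : ℤ) :
    Language.IsRegular {u : List (V → DigitPair b) | linIntPart a u = c} := by
  -- The interval [-C, C] is preserved: |t| ≤ (b - 1) C gives |c - t| ≤ b C.
  set C := max |c| (∑ v, |a v|)
  refine Language.IsRegular.of_finite_family
    (F := (fun c : ℤ => ({u | linIntPart a u = c} : Language (V → DigitPair b))) ''
      Set.Icc (-C) C ∪ {0}) (((Set.finite_Icc _ _).image _).union (Set.finite_singleton _)) ?_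
      (.inl ⟨c, abs_le.1 (le_max_left ..), rfl⟩)
  rintro _ (⟨c, hc, rfl⟩ | rfl) e
  · set t := ∑ v, a v * ((e v).1 : ℕ) with ht
    by_cases hd : (b : ℤ) ∣ c - t
    · obtain ⟨q, hq⟩ := hd
      refine .inl ⟨q, ?_, ?_⟩
      · have h1 : |t| ≤ (b - 1) * ∑ v, |a v| := abs_sum_digit_le a fun v => (e v).1
        have h2 : |t| ≤ (b - 1) * C :=
          h1.trans (mul_le_mul_of_nonneg_left (le_max_right ..) (by omega))
        have h3 : |(b : ℤ) * q| ≤ b * C := by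
          rw [← hq]
          have := abs_sub c t
          have := abs_le.2 hc
          linarith
        rw [abs_mul, abs_of_nonneg (by positivity)] at h3
        exact abs_le.1 (le_of_mul_le_mul_left h3 (by positivity))
      · ext u
        change linIntPart a u = q ↔ t + b * linIntPart a u = c
        have : (b : ℤ) ≠ 0 := by positivity
        replace hq : c = t + b * q := by linarith
        constructor
        · rintro rfl; linarith
        · intro h
          apply mul_left_cancel₀ this
          linarith
    · refine .inr ?_
      ext u
      change t + b * linIntPart a u = c ↔ False
      rw [iff_false]
      rintro rfl
      exact hd ⟨linIntPart a u, by ring⟩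
  · exact .inr rfl

/-- Fractional digits come highest first, so the target c becomes b c - t. A target exceeding ∑ |a
v| in absolute value is unattainable, which leaves finitely many nonempty languages. -/
theorem isRegular_linFracPart_eq (hb : 0 < b) (a : V → ℤ) (c : ℤ) :
    Language.IsRegular {u : List (V → DigitPair b) | linFracPart a u = c} := by
  set C := ∑ v, |a v| with hC
  have hmem : ∀ c : ℤ, ({u | linFracPart a u = c} : Language (V → DigitPair b)) ∈
      (fun c : ℤ => ({u | linFracPart a u = c} : Language (V → DigitPair b))) ''
      Set.Icc (-C) C ∪ {(0 : Language (V → DigitPair b))} := by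
    intro c
    by_cases hc : |c| ≤ C
    · exact .inl ⟨c, abs_le.1 hc, rfl⟩
    · refine .inr ?_
      refine Language.ext fun u => ?_
      change linFracPart a u = c ↔ False
      rw [iff_false]
      intro h
      have := abs_linFracPart_le a u
      rw [h] at this
      exact hc (by exact_mod_cast this)
  refine Language.IsRegular.of_finite_family
    (((Set.finite_Icc _ _).image _).union (Set.finite_singleton _)) ?_ (hmem c)
  rintro _ (⟨c, -, rfl⟩ | rfl) e
  · have heq : Language.leftQuotient {u | linFracPart a u = c} [e] =
        ({u | linFracPart a u = ((b * c - ∑ v, a v * ((e v).2 : ℕ) : ℤ) : ℝ)} : Language _) := by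
      refine Language.ext fun u => ?_
      change ((∑ v, a v * ((e v).2 : ℕ) : ℤ) + linFracPart a u) / b = (c : ℝ) ↔
        linFracPart a u = ((b * c - ∑ v, a v * ((e v).2 : ℕ) : ℤ) : ℝ)
      have : (b : ℝ) ≠ 0 := by positivity
      rw [div_eq_iff this]
      push_cast
      constructor <;> intro h <;> linarith
    change Language.leftQuotient {u | linFracPart a u = c} [e] ∈ _
    rw [heq]
    exact hmem _
  · exact .inr rfl

/-- The form splits into an integer part and a fractional part of absolute value at most ∑ |a v|. If
they add up to the integer c, the fractional part is one of finitely many integers t, and both parts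
are tested in parallel. The signs are absorbed into the coefficients. -/
theorem AutoSet.linear (hb : 0 < b) (a : V → ℤ) (c : ℤ) :
    AutoSet b {z : V → ℝ | ∑ v, a v * z v = c} := fun s => by
  set a' : V → ℤ := fun v => a v * s v with ha'
  set C := ∑ v, |a' v|
  refine (Language.IsRegular.finite_biUnion (Set.finite_Icc (-C) C) fun t _ =>
    (isRegular_linIntPart_eq hb a' (c - t)).inter (isRegular_linFracPart_eq hb a' t)).congr
    fun u => ?_
  have key : ∑ v, (a v : ℝ) * signedValue s u v = linIntPart a' u + linFracPart a' u := by
    rw [linIntPart_eq, linFracPart_eq]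
    push_cast
    rw [← Finset.sum_add_distrib]
    refine Finset.sum_congr rfl fun v _ => ?_
    simp only [signedValue, digitValue_eq, ha']
    push_cast
    ring
  change (∃ t ∈ Set.Icc (-C) C, linIntPart a' u = c - t ∧ linFracPart a' u = t) ↔
    ∑ v, (a v : ℝ) * signedValue s u v = c
  rw [key]
  constructor
  · rintro ⟨t, -, h1, h2⟩
    rw [h1, h2]
    push_cast
    ring
  · intro h
    have h1 : linFracPart a' u = ((c - linIntPart a' u : ℤ) : ℝ) := by
      push_cast
      linarith
    refine ⟨c - linIntPart a' u, ?_, by ring, h1⟩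
    have := abs_linFracPart_le a' u
    rw [h1] at this
    exact abs_le.1 (by exact_mod_cast this)

end Linear

/-! ### Automatic functions -/

/-- A function of several variables is automatic if it preserves `ℤ[1/b]` and its graph is an
automatic set. -/
structure AutoFun (b : ℕ) {V : Type} (F : (V → ℝ) → ℝ) : Prop where
  mem_zInv : ∀ z, (∀ v, z v ∈ zInv b) → F z ∈ zInv b
  graph : AutoSet b {p : V ⊕ Unit → ℝ | p (Sum.inr ()) = F (p ∘ Sum.inl)}

section AutoFun

variable {b : ℕ} {V W K : Type}

theorem AutoFun.graph_coord {F : (V → ℝ) → ℝ} (h : AutoFun b F) (ρ : V → W) (w : W) :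
    AutoSet b {p : W → ℝ | p w = F (p ∘ ρ)} :=
  h.graph.comap_coord (Sum.elim ρ fun _ => w)

/-- The preimage of an automatic set under a tuple of automatic functions is automatic. -/
theorem AutoSet.comap [Finite V] (hb : 1 < b) {X : Set (V → ℝ)} (hX : AutoSet b X)
    {φ : V → (W → ℝ) → ℝ} (hφ : ∀ v, AutoFun b (φ v)) :
    AutoSet b {z : W → ℝ | (fun v => φ v z) ∈ X} := by
  -- The values y = φ(z) are quantified existentially; `AutoFun.mem_zInv` makes the true values
  -- admissible witnesses.
  refine fun s => (AutoSet.exists_sumElim hb (U := V) ((hX.comap_coord Sum.inr).inter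
    (AutoSet.iInter fun v => (hφ v).graph_coord Sum.inl (Sum.inr v))) s).congr fun u => ?_
  have hz := signedValue_mem_zInv (b := b) (by omega) s u
  change (∃ y : V → ℝ, (∀ v, y v ∈ zInv b) ∧ y ∈ X ∧ _ ∈ ⋂ v, _) ↔
    (fun v => φ v (signedValue s u)) ∈ X
  simp only [Set.mem_iInter, Set.mem_ofPred_eq, Sum.elim_inr, Sum.elim_comp_inl]
  constructor
  · rintro ⟨y, -, hy, hy'⟩
    rwa [← funext hy']
  · exact fun h => ⟨_, fun v => (hφ v).mem_zInv _ hz, h, fun v => rfl⟩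

theorem AutoFun.coord (hb : 0 < b) [Fintype V] (v : V) : AutoFun b fun z : V → ℝ => z v := by
  classical
  refine ⟨fun z hz => hz v, ?_⟩
  have := AutoSet.linear (b := b) (V := V ⊕ Unit) hb
    (Sum.elim (fun w => if w = v then 1 else 0) fun _ => -1) 0
  convert this using 3
  simp only [Fintype.sum_sum_type, Sum.elim_inl, Sum.elim_inr]
  simp
  constructor <;> intro h <;> linarith

theorem AutoFun.restrict {F : (V → ℝ) → ℝ} (hF : AutoFun b F) (ρ : V → W) :
    AutoFun b fun z : W → ℝ => F (z ∘ ρ) :=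
  ⟨fun _ hz => hF.mem_zInv _ fun v => hz (ρ v), hF.graph_coord (Sum.inl ∘ ρ) (Sum.inr ())⟩

theorem AutoFun.comp [Finite V] [Fintype W] (hb : 1 < b) {F : (V → ℝ) → ℝ} (hF : AutoFun b F)
    {φ : V → (W → ℝ) → ℝ} (hφ : ∀ v, AutoFun b (φ v)) :
    AutoFun b fun z : W → ℝ => F fun v => φ v z := by
  refine ⟨fun z hz => hF.mem_zInv _ fun v => (hφ v).mem_zInv z hz, ?_⟩
  refine AutoSet.comap hb hF.graph (φ := Sum.elim (fun v (p : W ⊕ Unit → ℝ) => φ v (p ∘ Sum.inl))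
    fun _ p => p (Sum.inr ())) ?_
  rintro (v | ⟨⟩)
  · exact (hφ v).restrict Sum.inl
  · exact AutoFun.coord (by omega) _

/-- After clearing the denominator the graph is given by an integer linear equation; evenness of b
is needed for the values to lie in ℤ[1/b]. -/
theorem AutoFun.affine [Fintype V] (hb : 0 < b) (hb2 : 2 ∣ b) (a : V → ℤ) (c : ℤ) (n : ℕ) :
    AutoFun b fun z : V → ℝ => (∑ v, a v * z v + c) / 2 ^ n := by
  refine ⟨fun z hz => div_two_pow_mem_zInv hb hb2 (zInv_add hb (zInv_sum hb _ fun v _ =>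
    zInv_mul (intCast_mem_zInv _) (hz v)) (intCast_mem_zInv c)) n, ?_⟩
  have := AutoSet.linear (b := b) (V := V ⊕ Unit) hb (Sum.elim (fun v => -a v) fun _ => 2 ^ n) c
  convert this using 3
  simp
  rw [eq_div_iff (by positivity)]
  constructor <;> intro h <;> linarith

theorem AutoFun.affine_comp [Fintype V] [Fintype W] (hb : 0 < b) (hb2 : 2 ∣ b) (a : V → ℤ) (c : ℤ)
    (n : ℕ) {φ : V → (W → ℝ) → ℝ} (hφ : ∀ v, AutoFun b (φ v)) :
    AutoFun b fun z : W → ℝ => (∑ v, a v * φ v z + c) / 2 ^ n :=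
  (AutoFun.affine hb hb2 a c n).comp (by obtain ⟨k, rfl⟩ := hb2; omega) hφ

/-- A function of one of the variables, of the form `x ↦ (a x + c) / 2 ^ n`. -/
theorem AutoFun.affine_coord [Fintype V] (hb : 0 < b) (hb2 : 2 ∣ b) (v : V) (a c : ℤ) (n : ℕ) :
    AutoFun b fun z : V → ℝ => (a * z v + c) / 2 ^ n := by
  simpa using AutoFun.affine_comp hb hb2 (fun _ : Unit => a) c n fun _ => AutoFun.coord hb v

end AutoFun

/-! ### Recognizable relations of codes and automatic sets -/

section Code

variable {b : ℕ} [NeZero b]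

/-- The sign symbol. -/
def signDigit (b : ℕ) [NeZero b] (s : ℤˣ) : DigitPair b := if s = 1 then (0, 0) else (1, 1)

/-- Remove the redundant zeros at the end of a word of digit pairs. -/
def stripZeros : List (DigitPair b) → List (DigitPair b)
  | [] => []
  | e :: u => if e = 0 ∧ stripZeros u = [] then [] else e :: stripZeros u

/-- A word of digit pairs without redundant zeros at the end. -/
def IsStripped (u : List (DigitPair b)) : Prop := ∀ e ∈ u.getLast?, e ≠ 0

theorem isStripped_nil : IsStripped ([] : List (DigitPair b)) := by simp [IsStripped]

theorem isStripped_cons (e : DigitPair b) (u : List (DigitPair b)) :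
    IsStripped (e :: u) ↔ IsStripped u ∧ (e = 0 → u ≠ []) := by
  cases u with
  | nil => simp [IsStripped]
  | cons a u => simp [IsStripped, List.getLast?_cons]

theorem isStripped_stripZeros (u : List (DigitPair b)) : IsStripped (stripZeros u) := by
  induction u with
  | nil => exact isStripped_nil
  | cons e u ih =>
    rw [stripZeros]
    split_ifs with h
    · exact isStripped_nil
    · exact (isStripped_cons ..).2 ⟨ih, fun h0 h1 => h ⟨h0, h1⟩⟩

theorem exists_eq_stripZeros_append (u : List (DigitPair b)) :
    ∃ n, u = stripZeros u ++ List.replicate n 0 := by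
  induction u with
  | nil => exact ⟨0, rfl⟩
  | cons e u ih =>
    obtain ⟨n, hn⟩ := ih
    rw [stripZeros]
    split_ifs with h
    · refine ⟨n + 1, ?_⟩
      rw [h.2] at hn
      rw [hn, h.1]
      rfl
    · exact ⟨n, by rw [List.cons_append, ← hn]⟩

theorem digitValue_stripZeros (u : List (DigitPair b)) :
    digitValue (stripZeros u) = digitValue u := by
  obtain ⟨n, hn⟩ := exists_eq_stripZeros_append u
  conv_rhs => rw [hn, digitValue_append_replicate]

theorem IsStripped.digitValue_pos {u : List (DigitPair b)} (h : IsStripped u) (hu : u ≠ []) :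
    0 < digitValue u := by
  have hb : (0 : ℝ) < b := by have := NeZero.pos b; positivity
  induction u with
  | nil => exact (hu rfl).elim
  | cons e u ih =>
    rw [isStripped_cons] at h
    rw [digitValue_eq]
    have h1 := fracPart_nonneg u
    simp only [intPart, fracPart]
    push_cast
    by_cases he : e = 0
    · have h2 := ih h.1 (h.2 he)
      rw [digitValue_eq] at h2
      rcases h1.eq_or_lt with h3 | h3
      · rw [← h3, add_zero] at h2
        positivity
      · positivity
    · by_cases h3 : e.1 = 0
      · have h4 : e.2 ≠ 0 := fun h4 => he (Prod.ext h3 h4)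
        have h5 : (0 : ℝ) < ((e.2 : ℕ) : ℝ) := by
          exact_mod_cast Nat.pos_of_ne_zero fun h => h4 (Fin.ext (by simpa using h))
        positivity
      · have h5 : (0 : ℝ) < ((e.1 : ℕ) : ℝ) := by
          exact_mod_cast Nat.pos_of_ne_zero fun h => h3 (Fin.ext (by simpa using h))
        positivity

theorem stripZeros_eq_nil_iff (u : List (DigitPair b)) : stripZeros u = [] ↔ digitValue u = 0 := by
  rw [← digitValue_stripZeros u]
  constructor
  · intro h; rw [h, digitValue_nil]
  · intro h
    by_contra hu
    exact ((isStripped_stripZeros u).digitValue_pos hu).ne' h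

/-- The condition on s = -1 excludes a negative zero; together with strippedness it forces z < 0, by
`IsStripped.digitValue_pos`. -/
theorem isCode_iff (hb : 1 < b) (z : ℝ) (w : List (DigitPair b)) :
    IsCode b z w ↔ ∃ (s : ℤˣ) (u : List (DigitPair b)), w = signDigit b s :: u ∧ IsStripped u ∧
      (s = -1 → u ≠ []) ∧ z = ((s : ℤ) : ℝ) * digitValue u := by
  have h1 : ((1 : Fin b) : ℕ) = 1 := by
    rw [Fin.coe_ofNat_eq_mod, Nat.mod_eq_of_lt hb]
  have h0 : ∀ e : Fin b, (e : ℕ) = 0 ↔ e = 0 := fun e => Fin.val_eq_zero_iff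
  have h1' : ∀ e : Fin b, (e : ℕ) = 1 ↔ e = 1 := fun e => by rw [Fin.ext_iff, h1]
  have hstr : ∀ u : List (DigitPair b), (∀ e ∈ u.getLast?, (e.1 : ℕ) ≠ 0 ∨ (e.2 : ℕ) ≠ 0) ↔
      IsStripped u := by
    intro u
    refine forall₂_congr fun e _ => ?_
    rw [ne_eq, ne_eq, h0, h0, ← not_and_or, ne_eq, Prod.ext_iff]
    rfl
  unfold IsCode
  simp only [hstr, h0, h1']
  constructor
  · rintro ⟨s, u, rfl, hu, hz, ⟨hz0, hs⟩ | ⟨hz0, hs⟩⟩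
    · refine ⟨1, u, ?_, hu, by simp, by simp [hz, abs_of_nonneg hz0]⟩
      rw [signDigit, if_pos rfl]
      exact congrArg (· :: u) (Prod.ext hs.1 hs.2)
    · refine ⟨-1, u, ?_, hu, ?_, by simp [hz, abs_of_neg hz0]⟩
      · rw [signDigit, if_neg (by decide)]
        exact congrArg (· :: u) (Prod.ext hs.1 hs.2)
      · rintro - rfl
        rw [digitValue_nil, eq_comm, abs_eq_zero] at hz
        exact hz0.ne hz
  · rintro ⟨s, u, rfl, hu, hs, rfl⟩
    have h2 := digitValue_nonneg u
    refine ⟨_, u, rfl, hu, ?_, ?_⟩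
    · rcases Int.units_eq_one_or s with rfl | rfl <;> simp [abs_of_nonneg h2]
    · rcases Int.units_eq_one_or s with rfl | rfl
      · simp [signDigit, h2]
      · simp [signDigit, hu.digitValue_pos (hs rfl), show ¬((-1 : ℤˣ) = 1) by decide]

theorem signDigit_injective (hb : 1 < b) : Function.Injective (signDigit b) := by
  have h1 : ((1 : Fin b) : ℕ) = 1 := by
    rw [Fin.coe_ofNat_eq_mod, Nat.mod_eq_of_lt hb]
  have h : (0 : Fin b) ≠ 1 := fun h => by
    have := congrArg Fin.val h
    rw [h1, Fin.val_zero] at this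
    omega
  intro s t hst
  rcases Int.units_eq_one_or s with rfl | rfl <;> rcases Int.units_eq_one_or t with rfl | rfl <;>
    simp [signDigit, show ¬((-1 : ℤˣ) = 1) by decide, h, h.symm] at hst ⊢

/-- Since `codeRel` collects all codes of a tuple, this is the only direction of uniqueness that is
needed. -/
theorem IsCode.unique (hb : 1 < b) {z z' : ℝ} {w : List (DigitPair b)} (h : IsCode b z w)
    (h' : IsCode b z' w) : z = z' := by
  rw [isCode_iff hb] at h h'
  obtain ⟨s, u, rfl, -, -, rfl⟩ := h
  obtain ⟨s', u', h, -, -, rfl⟩ := h'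
  rw [List.cons.injEq] at h
  rw [signDigit_injective hb h.1, h.2]

/-- The relation formed by the codes of the elements of a set of tuples of numbers. -/
def codeRel (b : ℕ) {k : ℕ} (X : Set (Fin k → ℝ)) : Set (Fin k → List (DigitPair b)) :=
  {w | ∃ z ∈ X, ∀ j, IsCode b (z j) (w j)}

variable {k : ℕ}

/-- The code of the number represented by a sign and a word of digit pairs. -/
def signedCode (s : ℤˣ) (u : List (DigitPair b)) : List (DigitPair b) :=
  signDigit b (if stripZeros u = [] then 1 else s) :: stripZeros u

theorem isCode_signedCode (hb : 1 < b) (s : ℤˣ) (u : List (DigitPair b)) :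
    IsCode b (((s : ℤ) : ℝ) * digitValue u) (signedCode s u) := by
  rw [isCode_iff hb]
  refine ⟨_, _, rfl, isStripped_stripZeros u, ?_, ?_⟩
  · intro h h0
    rw [if_pos h0] at h
    exact absurd h (by decide)
  · rw [digitValue_stripZeros]
    split_ifs with h
    · rw [stripZeros_eq_nil_iff] at h
      simp [h]
    · rfl

theorem convolution_signedCode_mem_iff (hb : 1 < b) (X : Set (Fin k → ℝ)) (s : Fin k → ℤˣ)
    (u : List (Fin k → DigitPair b)) :
    (convolution fun j => signedCode (s j) (u.map fun e => e j)) ∈ convolution '' codeRel b X ↔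
      signedValue s u ∈ X := by
  rw [convolution_injective.mem_set_image]
  constructor
  · rintro ⟨z, hz, h⟩
    convert hz
    ext1 j
    exact (isCode_signedCode hb _ _).unique hb (h j)
  · exact fun h => ⟨_, h, fun j => isCode_signedCode hb _ _⟩

/-- The tracks of a word which contain a nonzero digit pair. -/
def aliveTracks (u : List (Fin k → DigitPair b)) : Set (Fin k) :=
  {j | stripZeros (u.map fun e => e j) ≠ []}

theorem aliveTracks_cons (e : Fin k → DigitPair b) (u : List (Fin k → DigitPair b)) :
    aliveTracks (e :: u) = {j | e j ≠ 0} ∪ aliveTracks u := by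
  ext j
  simp only [aliveTracks, List.map_cons, stripZeros, Set.mem_union, Set.mem_ofPred_eq]
  split_ifs with h
  · simp [h]
  · exact iff_of_true (by simp) (not_and_or.1 h)

open Classical in
-- A letter survives stripping iff its track has a nonzero pair there or later. Thus each column of
-- the padded word yields one column of the stripped convolution, or none if all tracks are dead.
theorem convolution_stripZeros_cons (e : Fin k → DigitPair b) (u : List (Fin k → DigitPair b)) :
    (convolution fun j => stripZeros ((e :: u).map fun e => e j)) =
      if aliveTracks (e :: u) = ∅ then (convolution fun j => stripZeros (u.map fun e => e j)) else
        (fun j => if j ∈ aliveTracks (e :: u) then some (e j) else none) ::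
          (convolution fun j => stripZeros (u.map fun e => e j)) := by
  split_ifs with h
  · rw [convolution_of_forall_nil, convolution_of_forall_nil]
    · rw [aliveTracks_cons, Set.union_empty_iff] at h
      intro j
      by_contra hj
      exact (Set.ext_iff.1 h.2 j).1 hj
    · intro j
      by_contra hj
      exact (Set.ext_iff.1 h j).1 hj
  · obtain ⟨j₀, hj₀⟩ := Set.nonempty_iff_ne_empty.2 h
    refine convolution_eq_cons_iff.2 ⟨⟨j₀, hj₀⟩, fun j => ?_, ?_⟩
    · simp only [aliveTracks, List.map_cons, stripZeros, Set.mem_ofPred_eq]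
      split_ifs <;> simp_all
    · congr 1
      ext1 j
      simp only [List.map_cons, stripZeros]
      split_ifs with h' <;> simp [h']

theorem AutoSet.of_faRecognizable (hb : 1 < b) (hk : 0 < k) {X : Set (Fin k → ℝ)}
    (h : FARecognizable (codeRel b X)) : AutoSet b X := by
  classical
  obtain ⟨σ, _, M, hM⟩ := h
  -- Whether a zero is redundant depends on the letters still to come. The state `g` therefore
  -- records, for each possible set of tracks alive in the remaining word, the state that `M` would
  -- have reached.
  let P : (Set (Fin k) → σ) → Language (Fin k → DigitPair b) := fun g =>
    {u | M.evalFrom (g (aliveTracks u)) (convolution fun j => stripZeros (u.map fun e => e j)) ∈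
      M.accept}
  have hP : ∀ g, (P g).IsRegular := by
    refine Language.IsRegular.of_finite_index P fun g e => ⟨fun S =>
      if {j | e j ≠ 0} ∪ S = ∅ then g ∅ else M.step (g ({j | e j ≠ 0} ∪ S))
        fun j => if j ∈ {j | e j ≠ 0} ∪ S then some (e j) else none, ?_⟩
    ext u
    change M.evalFrom (g (aliveTracks (e :: u)))
      (convolution fun j => stripZeros ((e :: u).map fun e => e j)) ∈ M.accept ↔
      M.evalFrom _ _ ∈ M.accept
    rw [convolution_stripZeros_cons, aliveTracks_cons]
    beta_reduce
    by_cases h0 : {j | e j ≠ 0} ∪ aliveTracks u = ∅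
    · rw [if_pos h0, if_pos h0, h0]
    · rw [if_neg h0, if_neg h0]
      change M.evalFrom (M.step _ _) _ ∈ M.accept ↔ _
      congr!
  intro s
  -- Initially `M` has read the sign column, in which a track that is zero throughout carries the
  -- sign +.
  refine (hP fun S => M.step M.start fun j =>
    some (signDigit b (if j ∈ S then s j else 1))).congr fun u => ?_
  change M.evalFrom _ _ ∈ M.accept ↔ signedValue s u ∈ X
  rw [← convolution_signedCode_mem_iff hb, ← hM,
    convolution_of_exists_ne_nil (w := fun j => signedCode (s j) (u.map fun e => e j))
      ⟨⟨0, hk⟩, by simp [signedCode]⟩]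
  simp only [signedCode, List.head?_cons, List.tail_cons, ← ite_not (stripZeros _ = [])]
  change _ ↔ M.evalFrom (M.step M.start _) _ ∈ M.accept
  congr!

/-- `Prop` serves as the two-element state set: after a letter, the state says whether that letter
was zero, in which case the word must not end. -/
theorem isRegular_isStripped (p : Prop) :
    Language.IsRegular {u : List (DigitPair b) | IsStripped u ∧ (p → u ≠ [])} := by
  refine Language.IsRegular.of_finite_index
    (fun p => ({u | IsStripped u ∧ (p → u ≠ [])} : Language (DigitPair b)))
    (fun p e => ⟨e = 0, ?_⟩) p
  ext u
  change IsStripped (e :: u) ∧ (p → e :: u ≠ []) ↔ IsStripped u ∧ (e = 0 → u ≠ [])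
  simp [isStripped_cons]

theorem map_convolution_getD (w : Fin k → List (DigitPair b)) (j : Fin k) :
    ∃ n, ((convolution w).map fun c => (c j).getD 0) = w j ++ List.replicate n 0 := by
  refine ⟨_, (?_ : _ = _).trans (map_range_getD (w j) 0
    (Finset.le_sup (f := fun j => (w j).length) (Finset.mem_univ j)))⟩
  simp [convolution, Function.comp_def]

theorem signedValue_map_convolution (s : Fin k → ℤˣ) (w : Fin k → List (DigitPair b)) :
    signedValue s ((convolution w).map fun c j => (c j).getD 0) =
      fun j => ((s j : ℤ) : ℝ) * digitValue (w j) := by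
  ext j
  obtain ⟨n, hn⟩ := map_convolution_getD w j
  simp only [signedValue, List.map_map]
  rw [← digitValue_append_replicate (w j) n, ← hn]
  rfl

theorem AutoSet.faRecognizable (hb : 1 < b) (hk : 0 < k) {X : Set (Fin k → ℝ)}
    (h : AutoSet b X) : FARecognizable (codeRel b X) := by
  classical
  let Y : (Fin k → ℤˣ) → Language (Fin k → Option (DigitPair b)) := fun s =>
    {v | v ∈ ({v | ∃ w : Fin k → List (DigitPair b), convolution w = v ∧
        ∀ j, w j ∈ ({u | IsStripped u ∧ (s j = -1 → u ≠ [])} : Language (DigitPair b))} :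
          Language (Fin k → Option (DigitPair b))) ∧
      v ∈ ({v | (v.map fun c j => (c j).getD 0) ∈
        ({u | signedValue s u ∈ X} : Language (Fin k → DigitPair b))} : Language _)}
  have hY : ∀ s, (Y s).IsRegular := fun s =>
    (isRegular_image_convolution fun j => isRegular_isStripped (s j = -1)).inter
      ((h s).comap_map fun (c : Fin k → Option (DigitPair b)) j => (c j).getD 0)
  -- The first column `a` of a convolution of codes fixes the signs; what follows lies in `Y s`.
  refine Language.IsRegular.of_leftQuotient fun a => ?_
  refine (Language.IsRegular.finite_biUnion
    (Set.toFinite {s : Fin k → ℤˣ | (fun j => some (signDigit b (s j))) = a}) (L := Y)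
    fun s _ => hY s).congr fun v => ?_
  change (∃ s : Fin k → ℤˣ, (fun j => some (signDigit b (s j))) = a ∧
    (∃ w : Fin k → List (DigitPair b), convolution w = v ∧
      ∀ j, IsStripped (w j) ∧ (s j = -1 → w j ≠ [])) ∧
      signedValue s (v.map fun c j => (c j).getD 0) ∈ X) ↔
    ∃ w ∈ codeRel b X, convolution w = a :: v
  constructor
  · rintro ⟨s, rfl, ⟨w, rfl, hw⟩, hX⟩
    rw [signedValue_map_convolution] at hX
    refine ⟨fun j => signDigit b (s j) :: w j, ⟨_, hX, fun j => ?_⟩, ?_⟩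
    · exact (isCode_iff hb _ _).2 ⟨_, _, rfl, (hw j).1, (hw j).2, rfl⟩
    · exact convolution_eq_cons_iff.2 ⟨⟨⟨0, hk⟩, by simp⟩, fun j => rfl, rfl⟩
  · rintro ⟨w, ⟨z, hz, hw⟩, hv⟩
    choose s u hsu hu hs hzs using fun j => (isCode_iff hb _ _).1 (hw j)
    obtain rfl : w = fun j => signDigit b (s j) :: u j := funext hsu
    obtain ⟨-, h1, rfl⟩ := convolution_eq_cons_iff.1 hv
    refine ⟨s, funext h1, ⟨u, rfl, fun j => ⟨hu j, hs j⟩⟩, ?_⟩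
    rw [signedValue_map_convolution]
    exact funext hzs ▸ hz

theorem faRecognizable_codeRel_iff (hb : 1 < b) (hk : 0 < k) {X : Set (Fin k → ℝ)} :
    FARecognizable (codeRel b X) ↔ AutoSet b X :=
  ⟨.of_faRecognizable hb hk, fun h => h.faRecognizable hb hk⟩

end Code

/-! ### The two-scale relation -/

section TwoScale

theorem knot_le_iff {ℓ : ℕ} {i : ℤ} {t : ℝ} : knot ℓ i ≤ t ↔ (i : ℝ) ≤ 2 ^ ℓ * t := by
  rw [knot, div_le_iff₀ (by positivity), mul_comm]

theorem le_knot_iff {ℓ : ℕ} {i : ℤ} {t : ℝ} : t ≤ knot ℓ i ↔ 2 ^ ℓ * t ≤ i := by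
  rw [knot, le_div_iff₀ (by positivity), mul_comm]

theorem knot_lt_iff {ℓ : ℕ} {i : ℤ} {t : ℝ} : knot ℓ i < t ↔ (i : ℝ) < 2 ^ ℓ * t := by
  rw [knot, div_lt_iff₀ (by positivity), mul_comm]

theorem lt_knot_iff {ℓ : ℕ} {i : ℤ} {t : ℝ} : t < knot ℓ i ↔ 2 ^ ℓ * t < i := by
  rw [knot, lt_div_iff₀ (by positivity), mul_comm]

theorem bspline_zero (ℓ : ℕ) (i : ℤ) (t : ℝ) :
    bspline ℓ 0 i t = if (i : ℝ) ≤ 2 ^ ℓ * t ∧ 2 ^ ℓ * t < i + 1 then 1 else 0 := by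
  simp only [bspline, knot_le_iff, lt_knot_iff, Int.cast_add, Int.cast_one]

theorem bspline_succ (ℓ m : ℕ) (i : ℤ) (t : ℝ) :
    bspline ℓ (m + 1) i t = ((2 ^ ℓ * t - i) * bspline ℓ m i t +
      (i + m + 2 - 2 ^ ℓ * t) * bspline ℓ m (i + 1) t) / (m + 1) := by
  have h1 : (m + 1 : ℝ) ≠ 0 := by positivity
  have h2 : (2 ^ ℓ : ℝ) ≠ 0 := by positivity
  rw [bspline]
  simp only [knot]
  push_cast
  rw [show ((i : ℝ) + (m + 1)) / 2 ^ ℓ - i / 2 ^ ℓ = (m + 1) / 2 ^ ℓ by ring,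
    show ((i : ℝ) + (m + 2)) / 2 ^ ℓ - (i + 1) / 2 ^ ℓ = (m + 1) / 2 ^ ℓ by ring]
  field_simp
  ring

/-- The induction step of `bspline_two_scale`, with x = 2^{ℓ+1} t - 2i and B k the degree m
B-splines of the finer level. Pascal's rule on the left leaves a difference that cancels by k
C(m+1,k) = (m+1) C(m,k-1) and (m+1-k) C(m+1,k) = (m+1) C(m,k). -/
theorem sum_choose_two_scale (m : ℕ) (x : ℝ) (B : ℕ → ℝ) :
    ∑ k ∈ Finset.range (m + 3), ((m + 2).choose k : ℝ) *
        ((x - k) * B k + (m + 2 + k - x) * B (k + 1)) =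
      ∑ k ∈ Finset.range (m + 2), ((m + 1).choose k : ℝ) *
        (x * B k + (2 * m + 4 - x) * B (k + 2)) := by
  have pascal : ∀ (n : ℕ) (a : ℕ → ℝ), ∑ k ∈ Finset.range (n + 2), ((n + 1).choose k : ℝ) * a k =
      ∑ k ∈ Finset.range (n + 1), (n.choose k : ℝ) * (a k + a (k + 1)) := by
    intro n a
    have := Finset.sum_choose_succ_mul (fun i _ => a i) n
    simp only [this, mul_add, Finset.sum_add_distrib]
  rw [pascal (m + 1), ← sub_eq_zero, ← Finset.sum_sub_distrib]
  have h1 : ∑ k ∈ Finset.range (m + 2), ((m + 1).choose k : ℝ) * (k * B k) =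
      (m + 1) * ∑ k ∈ Finset.range (m + 1), (m.choose k : ℝ) * B (k + 1) := by
    rw [Finset.sum_range_succ', Finset.mul_sum]
    simp only [Nat.cast_zero, zero_mul, mul_zero, add_zero]
    refine Finset.sum_congr rfl fun k _ => ?_
    have : ((m + 1 : ℕ) : ℝ) * m.choose k = (m + 1).choose (k + 1) * (k + 1 : ℕ) := by
      exact_mod_cast Nat.add_one_mul_choose_eq m k
    push_cast at this ⊢
    rw [← mul_assoc, ← mul_assoc, this]
  have h2 : ∑ k ∈ Finset.range (m + 2), ((m + 1).choose k : ℝ) * ((m + 1 - k) * B (k + 2)) =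
      (m + 1) * ∑ k ∈ Finset.range (m + 1), (m.choose k : ℝ) * B (k + 2) := by
    rw [Finset.sum_range_succ, Finset.mul_sum]
    simp only [Nat.cast_add, Nat.cast_one, sub_self, zero_mul, mul_zero, add_zero]
    refine Finset.sum_congr rfl fun k hk => ?_
    have hk' : k ≤ m := Nat.lt_succ_iff.1 (Finset.mem_range.1 hk)
    have : ((m + 1).choose k : ℝ) * ((m + 1 - k : ℕ) : ℝ) = (m + 1) * m.choose k := by
      have := Nat.choose_mul_succ_eq m k
      rw [← Nat.cast_mul, ← this]
      push_cast
      ring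
    rw [Nat.cast_sub (by omega)] at this
    push_cast at this
    rw [← mul_assoc, this, mul_assoc]
  have h3 := pascal m fun k => B (k + 1)
  simp only [mul_add, Finset.sum_add_distrib] at h3
  have : ∑ k ∈ Finset.range (m + 2), (((m + 1).choose k : ℝ) *
      ((x - k) * B k + (m + 2 + k - x) * B (k + 1) +
        ((x - (k + 1 : ℕ)) * B (k + 1) + (m + 2 + (k + 1 : ℕ) - x) * B (k + 1 + 1))) -
      ((m + 1).choose k : ℝ) * (x * B k + (2 * m + 4 - x) * B (k + 2))) =
      (m + 1) * ∑ k ∈ Finset.range (m + 2), ((m + 1).choose k : ℝ) * B (k + 1) -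
      ∑ k ∈ Finset.range (m + 2), ((m + 1).choose k : ℝ) * (k * B k) -
      ∑ k ∈ Finset.range (m + 2), ((m + 1).choose k : ℝ) * ((m + 1 - k) * B (k + 2)) := by
    rw [Finset.mul_sum, ← Finset.sum_sub_distrib, ← Finset.sum_sub_distrib]
    refine Finset.sum_congr rfl fun k _ => ?_
    push_cast
    ring
  rw [this, h1, h2, h3]
  ring

theorem bspline_two_scale (ℓ m : ℕ) (i : ℤ) (t : ℝ) :
    bspline ℓ m i t = ∑ k ∈ Finset.range (m + 2),
      ((m + 1).choose k : ℝ) / 2 ^ m * bspline (ℓ + 1) m (2 * i + k) t := by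
  induction m generalizing i with
  | zero =>
    have h : ∀ n : ℤ, bspline (ℓ + 1) 0 n t = if n ≤ 2 * (2 ^ ℓ * t) ∧ 2 * (2 ^ ℓ * t) < n + 1
        then 1 else 0 := by
      intro n
      rw [bspline_zero, show (2 : ℝ) ^ (ℓ + 1) * t = 2 * (2 ^ ℓ * t) by ring]
    have h' := bspline_zero ℓ i t
    simp only [Finset.sum_range_succ, Finset.sum_range_zero, h, h']
    push_cast
    generalize (2 : ℝ) ^ ℓ * t = τ
    by_cases h1 : (i : ℝ) ≤ τ
    · by_cases h2 : τ < i + 1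
      · by_cases h3 : 2 * τ < 2 * i + 1
        · rw [if_pos ⟨h1, h2⟩, if_pos ⟨by linarith, by linarith⟩, if_neg fun h => by linarith [h.1]]
          simp
        · rw [if_pos ⟨h1, h2⟩, if_neg fun h => by linarith [h.2],
            if_pos ⟨by linarith, by linarith⟩]
          simp
      · rw [if_neg fun h => h2 h.2, if_neg fun h => by linarith [h.2],
          if_neg fun h => by linarith [h.2]]
        simp
    · rw [if_neg fun h => h1 h.1, if_neg fun h => by linarith [h.1],
          if_neg fun h => by linarith [h.1]]
      simp
  | succ m ih =>
    set x : ℝ := 2 ^ (ℓ + 1) * t - 2 * i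
    have hk := sum_choose_two_scale m x fun k => bspline (ℓ + 1) m (2 * i + k) t
    have h0 : (m + 1 : ℝ) ≠ 0 := by positivity
    have e1 : ∑ k ∈ Finset.range (m + 1 + 2), ((m + 1 + 1).choose k : ℝ) / 2 ^ (m + 1) *
        bspline (ℓ + 1) (m + 1) (2 * i + k) t =
        (∑ k ∈ Finset.range (m + 3), ((m + 2).choose k : ℝ) *
          ((x - k) * bspline (ℓ + 1) m (2 * i + k) t +
            (m + 2 + k - x) * bspline (ℓ + 1) m (2 * i + (k + 1 : ℕ)) t)) /
          (2 ^ (m + 1) * (m + 1)) := by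
      rw [Finset.sum_div]
      refine Finset.sum_congr rfl fun k _ => ?_
      rw [bspline_succ]
      push_cast
      rw [add_assoc (2 * i)]
      simp only [x]
      field_simp
      ring
    rw [e1, hk, bspline_succ, ih i, ih (i + 1), Finset.mul_sum, Finset.mul_sum,
      ← Finset.sum_add_distrib, Finset.sum_div, Finset.sum_div]
    refine Finset.sum_congr rfl fun k _ => ?_
    rw [show 2 * (i + 1) + (k : ℤ) = 2 * i + (k + 2 : ℕ) by push_cast; ring]
    simp only [x]
    field_simp
    ring

theorem bspline_ne_zero {ℓ m : ℕ} {i : ℤ} {t : ℝ} (h : bspline ℓ m i t ≠ 0) :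
    (i : ℝ) ≤ 2 ^ ℓ * t ∧ 2 ^ ℓ * t < i + m + 1 := by
  induction m generalizing i with
  | zero =>
    rw [bspline_zero, ne_eq, ite_eq_right_iff, Classical.not_imp] at h
    simpa using h.1
  | succ m ih =>
    rw [bspline_succ] at h
    push_cast
    by_cases h1 : bspline ℓ m i t = 0
    · by_cases h2 : bspline ℓ m (i + 1) t = 0
      · simp [h1, h2] at h
      · have := ih h2
        push_cast at this
        constructor <;> linarith
    · have := ih h1
      constructor <;> linarith

variable {d : ℕ}

theorem tensorBspline_two_scale (m ℓ : ℕ) (i : Fin d → ℤ) (x : Fin d → ℝ) :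
    tensorBspline m ℓ i x = ∑ k : Fin d → Fin (m + 2),
      (∏ j, ((m + 1).choose (k j) : ℝ) / 2 ^ m) *
        tensorBspline m (ℓ + 1) (fun j => 2 * i j + (k j : ℕ)) x := by
  unfold tensorBspline
  simp only [← Finset.prod_mul_distrib]
  rw [← Fintype.piFinset_univ, ← Finset.prod_univ_sum (fun _ => Finset.univ)
    fun j (k : Fin (m + 2)) => ((m + 1).choose k : ℝ) / 2 ^ m *
      bspline (ℓ + 1) m (2 * i j + (k : ℕ)) (x j)]
  refine Finset.prod_congr rfl fun j _ => ?_
  rw [bspline_two_scale, Finset.sum_range]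

/-- Local finiteness: at a fixed point all sums over indices are finite, so rearranging them is
harmless. -/
theorem finite_tensorBspline_ne_zero (m ℓ : ℕ) (x : Fin d → ℝ) :
    {i : Fin d → ℤ | tensorBspline m ℓ i x ≠ 0}.Finite := by
  refine (Set.Finite.pi' (t := fun j => Set.Icc (⌊2 ^ ℓ * x j⌋ - m) ⌊2 ^ ℓ * x j⌋)
    fun j => Set.finite_Icc _ _).subset fun i hi j => ?_
  have := bspline_ne_zero (Finset.prod_ne_zero_iff.1 hi j (Finset.mem_univ j))
  refine ⟨?_, Int.le_floor.2 this.1⟩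
  have : ⌊2 ^ ℓ * x j⌋ < i j + m + 1 := Int.floor_lt.2 (by push_cast; exact this.2)
  linarith

/-- Knot insertion: the coefficients with respect to the B-splines of the next finer grid. -/
theorem hasSum_tensorBspline_succ (m ℓ : ℕ) (x : Fin d → ℝ) {a : (Fin d → ℤ) → ℝ} {S : ℝ}
    (h : HasSum (fun i => a i * tensorBspline m ℓ i x) S) :
    HasSum (fun i' => (∑ k : Fin d → Fin (m + 2), (∏ j, ((m + 1).choose (k j) : ℝ) / 2 ^ m) *
      Function.extend (fun (i : Fin d → ℤ) j => 2 * i j + (k j : ℕ)) a 0 i') *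
        tensorBspline m (ℓ + 1) i' x) S := by
  let φ : (Fin d → Fin (m + 2)) → (Fin d → ℤ) → (Fin d → ℤ) := fun k i j => 2 * i j + (k j : ℕ)
  have hφ : ∀ k, Function.Injective (φ k) := fun k i i' h => funext fun j => by
    have := congrFun h j
    simp only [φ] at this
    omega
  have hs : ∀ k, Summable fun i => a i * tensorBspline m (ℓ + 1) (φ k i) x := fun k =>
    summable_of_hasFiniteSupport (((finite_tensorBspline_ne_zero m (ℓ + 1) x).preimage
      (hφ k).injOn).subset fun i hi => right_ne_zero_of_mul hi)
  have h1 := hasSum_sum fun k (_ : k ∈ Finset.univ) =>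
    (hs k).hasSum.mul_left (∏ j, ((m + 1).choose (k j) : ℝ) / 2 ^ m)
  have h2 : S = _ := h.unique (h1.congr_fun fun i => by
    rw [tensorBspline_two_scale, Finset.mul_sum]
    exact Finset.sum_congr rfl fun k _ => by ring)
  rw [h2]
  -- For each offset `k`, the sum over coarse indices is moved along the injection `φ k` to all fine
  -- indices, with coefficient zero off its range.
  have h3 := hasSum_sum fun k (_ : k ∈ Finset.univ) =>
    (((hφ k).hasSum_iff (f := fun i' => Function.extend (φ k) a 0 i' *
      tensorBspline m (ℓ + 1) i' x) fun i' hi' => by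
        rw [Function.extend_apply' _ _ _ fun ⟨i, hi⟩ => hi' ⟨i, hi⟩]; simp).1
      ((hs k).hasSum.congr_fun fun i => by simp [(hφ k).extend_apply])).mul_left
        (∏ j, ((m + 1).choose (k j) : ℝ) / 2 ^ m)
  refine h3.congr_fun fun i' => ?_
  rw [Finset.sum_mul]
  exact Finset.sum_congr rfl fun k _ => by ring

end TwoScale

/-! ### Supports, cells and domains -/

section Geometry

variable {d : ℕ}

/-- The interior of the cell `gridCell ℓ i`. -/
def openCell (ℓ : ℕ) (i : Fin d → ℤ) : Set (Fin d → ℝ) :=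
  {x | ∀ j, knot ℓ (i j) < x j ∧ x j < knot ℓ (i j + 1)}

theorem openCell_subset_gridCell (ℓ : ℕ) (i : Fin d → ℤ) : openCell ℓ i ⊆ gridCell ℓ i :=
  fun _ hx j => ⟨(hx j).1.le, (hx j).2.le⟩

theorem barycentre_eq (ℓ : ℕ) (i : Fin d → ℤ) (j : Fin d) :
    barycentre ℓ i j = (2 * i j + 1) / 2 ^ (ℓ + 1) := by
  simp only [barycentre, knot]
  push_cast
  field_simp
  ring

theorem barycentre_mem_openCell (ℓ : ℕ) (i : Fin d → ℤ) : barycentre ℓ i ∈ openCell ℓ i := by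
  intro j
  have : (2 : ℝ) ^ ℓ * ((2 * i j + 1) / 2 ^ (ℓ + 1)) = i j + 1 / 2 := by
    rw [pow_succ]
    field_simp
  rw [barycentre_eq, knot_lt_iff, lt_knot_iff, this]
  push_cast
  constructor <;> linarith

theorem eq_of_mem_openCell_of_mem_gridCell {ℓ : ℕ} {i i' : Fin d → ℤ} {x : Fin d → ℝ}
    (h : x ∈ openCell ℓ i) (h' : x ∈ gridCell ℓ i') : i = i' := by
  ext j
  have h1 := h j
  have h2 := h' j
  rw [knot_lt_iff, lt_knot_iff] at h1
  rw [knot_le_iff, le_knot_iff] at h2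
  have h3 : i j < i' j + 1 := by exact_mod_cast h1.1.trans_le h2.2
  have h4 : i' j < i j + 1 := by exact_mod_cast h2.1.trans_lt h1.2
  omega

/-- A union of grid cells that meets the interior of a cell contains this cell. -/
theorem gridCell_subset_of_mem {ℓ : ℕ} {Ω : Set (Fin d → ℝ)} {M : Set (Fin d → ℤ)}
    (hΩ : Ω = ⋃ i ∈ M, gridCell ℓ i) {i : Fin d → ℤ} {x : Fin d → ℝ} (hx : x ∈ openCell ℓ i)
    (hxΩ : x ∈ Ω) : gridCell ℓ i ⊆ Ω := by
  rw [hΩ] at hxΩ ⊢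
  obtain ⟨i', hi', hx'⟩ := Set.mem_iUnion₂.1 hxΩ
  rw [eq_of_mem_openCell_of_mem_gridCell hx hx']
  exact Set.subset_biUnion_of_mem hi'

theorem knot_div_two_le (ℓ : ℕ) (n : ℤ) : knot ℓ (n / 2) ≤ knot (ℓ + 1) n := by
  rw [knot_le_iff, knot, pow_succ]
  have : ((n / 2 : ℤ) : ℝ) * 2 ≤ n := by exact_mod_cast Int.ediv_mul_le n two_ne_zero
  rw [mul_div_assoc', le_div_iff₀ (by positivity)]
  nlinarith [show (0 : ℝ) < 2 ^ ℓ by positivity]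

theorem le_knot_div_two_add_one (ℓ : ℕ) (n : ℤ) : knot (ℓ + 1) (n + 1) ≤ knot ℓ (n / 2 + 1) := by
  rw [le_knot_iff, knot, pow_succ]
  have : (n : ℝ) + 1 ≤ ((n / 2 : ℤ) + 1) * 2 := by
    have : n + 1 ≤ (n / 2 + 1) * 2 := by omega
    exact_mod_cast this
  rw [mul_div_assoc', div_le_iff₀ (by positivity)]
  push_cast
  nlinarith [show (0 : ℝ) < 2 ^ ℓ by positivity]

theorem gridCell_succ_subset (ℓ : ℕ) (i : Fin d → ℤ) :
    gridCell (ℓ + 1) i ⊆ gridCell ℓ fun j => i j / 2 :=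
  fun _ hx j => ⟨(knot_div_two_le ℓ (i j)).trans (hx j).1,
    (hx j).2.trans (le_knot_div_two_add_one ℓ (i j))⟩

theorem gridCellHalfOpen_succ_subset (ℓ : ℕ) (i : Fin d → ℤ) :
    gridCellHalfOpen (ℓ + 1) i ⊆ gridCellHalfOpen ℓ fun j => i j / 2 :=
  fun _ hx j => ⟨(knot_div_two_le ℓ (i j)).trans (hx j).1,
    (hx j).2.trans_le (le_knot_div_two_add_one ℓ (i j))⟩

theorem openCell_succ_subset (ℓ : ℕ) (i : Fin d → ℤ) :
    openCell (ℓ + 1) i ⊆ openCell ℓ fun j => i j / 2 :=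
  fun _ hx j => ⟨(knot_div_two_le ℓ (i j)).trans_lt (hx j).1,
    (hx j).2.trans_le (le_knot_div_two_add_one ℓ (i j))⟩

/-- The barycentre of the small cell lies in the interior of its parent, so a union of coarse cells
containing the small cell contains the parent. -/
theorem gridCell_succ_subset_iff {ℓ : ℕ} {Ω : Set (Fin d → ℝ)} {M : Set (Fin d → ℤ)}
    (hΩ : Ω = ⋃ i ∈ M, gridCell ℓ i) (i : Fin d → ℤ) :
    gridCell (ℓ + 1) i ⊆ Ω ↔ gridCell ℓ (fun j => i j / 2) ⊆ Ω :=
  ⟨fun h => gridCell_subset_of_mem hΩ (openCell_succ_subset ℓ i (barycentre_mem_openCell (ℓ + 1) i))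
    (h (openCell_subset_gridCell _ _ (barycentre_mem_openCell (ℓ + 1) i))),
    (gridCell_succ_subset ℓ i).trans⟩

theorem isOpen_bsplineSupport (m ℓ : ℕ) (i : Fin d → ℤ) : IsOpen (bsplineSupport m ℓ i) := by
  have : bsplineSupport m ℓ i =
      Set.univ.pi fun j => Set.Ioo (knot ℓ (i j)) (knot ℓ (i j + (m + 1))) := by
    ext x
    simp [bsplineSupport]
  rw [this]
  exact isOpen_set_pi Set.finite_univ fun j _ => isOpen_Ioo

theorem openCell_subset_bsplineSupport {m ℓ : ℕ} (i : Fin d → ℤ) (k : Fin d → Fin (m + 1)) :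
    openCell ℓ (fun j => i j + (k j : ℕ)) ⊆ bsplineSupport m ℓ i := by
  intro x hx j
  have h := hx j
  have hk : ((k j : ℕ) : ℝ) + 1 ≤ m + 1 := by exact_mod_cast (k j).2
  rw [knot_lt_iff, lt_knot_iff] at h ⊢
  push_cast at h ⊢
  constructor <;> linarith [(k j : ℕ).cast_nonneg (α := ℝ)]

theorem bsplineSupport_nonempty (m ℓ : ℕ) (i : Fin d → ℤ) : (bsplineSupport m ℓ i).Nonempty :=
  ⟨_, openCell_subset_bsplineSupport i 0 (barycentre_mem_openCell _ _)⟩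

theorem exists_mem_gridCell_of_mem_bsplineSupport {m ℓ : ℕ} {i : Fin d → ℤ} {x : Fin d → ℝ}
    (hx : x ∈ bsplineSupport m ℓ i) :
    ∃ k : Fin d → Fin (m + 1), x ∈ gridCell ℓ fun j => i j + (k j : ℕ) := by
  have h : ∀ j, i j ≤ ⌊2 ^ ℓ * x j⌋ ∧ ⌊2 ^ ℓ * x j⌋ < i j + (m + 1) := by
    intro j
    have := hx j
    rw [knot_lt_iff, lt_knot_iff] at this
    exact ⟨Int.le_floor.2 this.1.le, Int.floor_lt.2 this.2⟩
  refine ⟨fun j => ⟨(⌊2 ^ ℓ * x j⌋ - i j).toNat, by have := h j; omega⟩, fun j => ?_⟩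
  have : i j + ((⌊2 ^ ℓ * x j⌋ - i j).toNat : ℤ) = ⌊2 ^ ℓ * x j⌋ := by have := h j; omega
  rw [knot_le_iff, le_knot_iff]
  simp only [this]
  exact ⟨Int.floor_le _, by push_cast; exact (Int.lt_floor_add_one _).le⟩

/-- The support is open and, up to boundaries, made of (m+1)^d cells. The topological condition in
Kraft's selection becomes a finite conjunction that automata can test. -/
theorem bsplineSupport_subset_interior_iff {m ℓ : ℕ} {Ω : Set (Fin d → ℝ)}
    (hΩ : ∀ i x, x ∈ openCell ℓ i → x ∈ Ω → gridCell ℓ i ⊆ Ω) (i : Fin d → ℤ) :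
    bsplineSupport m ℓ i ⊆ interior Ω ↔
      ∀ k : Fin d → Fin (m + 1), gridCell ℓ (fun j => i j + (k j : ℕ)) ⊆ Ω := by
  rw [(isOpen_bsplineSupport m ℓ i).subset_interior_iff]
  constructor
  · intro h k
    have := barycentre_mem_openCell ℓ fun j => i j + (k j : ℕ)
    exact hΩ _ _ this (h (openCell_subset_bsplineSupport i k this))
  · intro h x hx
    obtain ⟨k, hk⟩ := exists_mem_gridCell_of_mem_bsplineSupport hx
    exact h k hk

theorem bsplineSupport_subset_interior_iff_same {m ℓ : ℕ} {Ω : Set (Fin d → ℝ)}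
    {M : Set (Fin d → ℤ)} (hΩ : Ω = ⋃ i ∈ M, gridCell ℓ i) (i : Fin d → ℤ) :
    bsplineSupport m ℓ i ⊆ interior Ω ↔
      ∀ k : Fin d → Fin (m + 1), gridCell ℓ (fun j => i j + (k j : ℕ)) ⊆ Ω :=
  bsplineSupport_subset_interior_iff (fun _ _ => gridCell_subset_of_mem hΩ) i

theorem bsplineSupport_subset_interior_iff_succ {m ℓ : ℕ} {Ω : Set (Fin d → ℝ)}
    {M : Set (Fin d → ℤ)} (hΩ : Ω = ⋃ i ∈ M, gridCell ℓ i) (i : Fin d → ℤ) :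
    bsplineSupport m (ℓ + 1) i ⊆ interior Ω ↔
      ∀ k : Fin d → Fin (m + 1), gridCell ℓ (fun j => (i j + (k j : ℕ)) / 2) ⊆ Ω := by
  rw [bsplineSupport_subset_interior_iff (fun i x hx hxΩ => (gridCell_succ_subset ℓ i).trans
    (gridCell_subset_of_mem hΩ (openCell_succ_subset ℓ i hx) hxΩ))]
  exact forall_congr' fun k => gridCell_succ_subset_iff hΩ _

theorem bsplineSupport_succ_subset {m ℓ : ℕ} (i : Fin d → ℤ) (k : Fin d → Fin (m + 2)) :
    bsplineSupport m (ℓ + 1) (fun j => 2 * i j + (k j : ℕ)) ⊆ bsplineSupport m ℓ i := by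
  intro x hx j
  have h := hx j
  have hk : ((k j : ℕ) : ℝ) + 1 ≤ m + 2 := by exact_mod_cast (k j).2
  rw [knot_lt_iff, lt_knot_iff] at h ⊢
  rw [pow_succ] at h
  push_cast at h ⊢
  constructor <;> linarith [(k j : ℕ).cast_nonneg (α := ℝ)]

/-- A fraction with odd numerator over a power of 2 is reduced. Consequently a barycentre determines
both the level and the index of its cell. -/
theorem two_mul_add_one_div_eq {a a' : ℤ} {n n' : ℕ}
    (h : (2 * a + 1 : ℝ) / 2 ^ n = (2 * a' + 1) / 2 ^ n') : n = n' ∧ a = a' := by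
  wlog hn : n ≤ n' generalizing a a' n n'
  · exact (this h.symm (by omega)).imp Eq.symm Eq.symm
  obtain ⟨r, rfl⟩ := Nat.exists_eq_add_of_le hn
  rw [pow_add, div_eq_div_iff (by positivity) (by positivity), mul_left_comm,
    mul_comm _ (2 ^ n : ℝ)] at h
  have h1 := mul_left_cancel₀ (by positivity) h
  have h2 : (2 * a + 1) * 2 ^ r = 2 * a' + 1 := by exact_mod_cast h1
  rcases Nat.eq_zero_or_pos r with rfl | hr
  · exact ⟨rfl, by simpa using h2⟩
  · obtain ⟨r, rfl⟩ := Nat.exists_eq_add_of_lt hr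
    rw [zero_add, pow_succ, ← mul_assoc] at h2
    omega

theorem barycentre_injective (hd : 0 < d) {ℓ ℓ' : ℕ} {i i' : Fin d → ℤ}
    (h : ∀ j, barycentre ℓ i j = barycentre ℓ' i' j) : ℓ = ℓ' ∧ i = i' := by
  simp only [barycentre_eq] at h
  exact ⟨by simpa using (two_mul_add_one_div_eq (h ⟨0, hd⟩)).1,
    funext fun j => (two_mul_add_one_div_eq (h j)).2⟩

end Geometry

/-! ### Refinement of hierarchical meshes -/

namespace HierarchicalMesh

variable {d : ℕ} {T T' : HierarchicalMesh d}

/-- Every cell of `T'` lies in a cell of `T`: it is itself one up to level `L`, and a level `L + 1`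
cell lies in its parent, which is contained in Ω^L. -/
theorem IsRefinementOf.splineSpace_subset (href : T'.IsRefinementOf T) (m : ℕ) :
    T.splineSpace m ⊆ T'.splineSpace m := by
  obtain ⟨hN, hΩ⟩ := href
  rintro f ⟨hf, hf'⟩
  refine ⟨hf, ?_⟩
  rintro ⟨ℓ, i⟩ ⟨hℓ, hc⟩
  simp only at hℓ hc
  rcases lt_or_ge (ℓ + 1) T.N with h1 | h1
  · refine hf' (ℓ, i) ⟨by simp only; omega, ?_⟩
    rwa [hΩ _ h1, hΩ _ (by omega)] at hc
  rcases h1.eq_or_lt with h2 | h2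
  · refine hf' (ℓ, i) ⟨by simp only; omega, ?_⟩
    simp only [T.Ω_eq_empty _ h1, interior_empty, Set.sdiff_empty]
    rw [hΩ _ (by omega)] at hc
    exact hc.trans Set.sdiff_subset
  · obtain ⟨L, hL⟩ : ∃ L, T.N = L + 1 := ⟨T.N - 1, by have := T.N_pos; omega⟩
    obtain rfl : ℓ = L + 1 := by omega
    obtain ⟨M, hM⟩ := T'.Ω_succ_eq_iUnion L
    have h3 := (gridCell_succ_subset_iff hM i).1 (hc.trans Set.sdiff_subset)
    obtain ⟨q, hq, hq'⟩ := hf' (L, fun j => i j / 2) ⟨by simp only; omega, by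
      simp only [T.Ω_eq_empty _ hL.le, interior_empty, Set.sdiff_empty]
      rw [← hΩ _ (by omega)]
      exact h3.trans (T'.Ω_succ_subset L)⟩
    exact ⟨q, hq, fun x hx => hq' x (gridCellHalfOpen_succ_subset L i hx)⟩

theorem mem_kraft_iff {m : ℕ} {p : ℕ × (Fin d → ℤ)} : p ∈ T.kraft m ↔ p.1 < T.N ∧
    bsplineSupport m p.1 p.2 ⊆ interior (T.Ω p.1) ∧
      ¬ bsplineSupport m p.1 p.2 ⊆ interior (T.Ω (p.1 + 1)) := by
  change _ ∧ _ ∩ _ = ∅ ∧ _ ↔ _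
  rw [← Set.sdiff_eq, Set.sdiff_eq_empty, ← Set.sdiff_eq, Set.sdiff_nonempty]

theorem not_bsplineSupport_subset_of_le {m ℓ ℓ' : ℕ} {i : Fin d → ℤ} (h : T.N ≤ ℓ') :
    ¬ bsplineSupport m ℓ i ⊆ interior (T.Ω ℓ') := by
  rw [T.Ω_eq_empty _ h, interior_empty, Set.subset_empty_iff]
  exact (bsplineSupport_nonempty m ℓ i).ne_empty

/-- The two meshes differ only in Ω^{L+1}, empty for `T`. So `T` rejects no level `L` function for
being too fine, whereas `T'` rejects those supported in the interior of Ω^{L+1}; at level `L + 1`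
nothing is rejected for that reason. -/
theorem IsRefinementOf.mem_kraft_iff {m L : ℕ} (href : T'.IsRefinementOf T) (hL : T.N = L + 1)
    {p : ℕ × (Fin d → ℤ)} : p ∈ T'.kraft m ↔
      (p ∈ T.kraft m ∧ ¬ (p.1 = L ∧ bsplineSupport m L p.2 ⊆ interior (T'.Ω (L + 1)))) ∨
        p.1 = L + 1 ∧ bsplineSupport m (L + 1) p.2 ⊆ interior (T'.Ω (L + 1)) := by
  obtain ⟨hN, hΩ⟩ := href
  obtain ⟨ℓ, i⟩ := p
  rw [HierarchicalMesh.mem_kraft_iff, HierarchicalMesh.mem_kraft_iff]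
  simp only
  rcases lt_trichotomy ℓ L with h | rfl | h
  · rw [hΩ _ (by omega), hΩ _ (by omega)]
    simp [h.ne, show ℓ < T.N by omega, show ℓ < T'.N by omega, show ℓ ≠ L + 1 by omega]
  · rw [hΩ _ (by omega)]
    simp [show ℓ < T.N by omega, show ℓ < T'.N by omega,
      T.not_bsplineSupport_subset_of_le (show T.N ≤ ℓ + 1 by omega)]
  · simp only [show ¬ ℓ < T.N by omega, false_and, false_or]
    constructor
    · rintro ⟨h1, h2, -⟩
      obtain rfl : ℓ = L + 1 := by omega
      exact ⟨rfl, h2⟩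
    · rintro ⟨rfl, h2⟩
      exact ⟨by omega, h2, T'.not_bsplineSupport_subset_of_le (by omega)⟩

theorem IsRefinementOf.mem_kraft_of_subset {m L : ℕ} (href : T'.IsRefinementOf T)
    (hL : T.N = L + 1) {i : Fin d → ℤ} (h : bsplineSupport m L i ⊆ interior (T'.Ω (L + 1))) :
    (L, i) ∈ T.kraft m := by
  rw [HierarchicalMesh.mem_kraft_iff]
  refine ⟨by simp only; omega, ?_, T.not_bsplineSupport_subset_of_le (by simp only; omega)⟩
  rw [← href.2 _ (by simp only; omega)]
  exact h.trans (interior_mono (T'.Ω_succ_subset L))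

end HierarchicalMesh

/-! ### Automatic sets of indices -/

section IndexSets

variable {d : ℕ}

/-- The integer vectors with a given property, as real vectors. -/
def intSet (P : (Fin d → ℤ) → Prop) : Set (Fin d → ℝ) := {x | ∃ i, P i ∧ x = fun j => (i j : ℝ)}

theorem intCast_vec_injective : Function.Injective fun (i : Fin d → ℤ) (j : Fin d) => (i j : ℝ) :=
  fun _ _ h => funext fun j => Int.cast_injective (congrFun h j)

theorem intCast_mem_intSet {P : (Fin d → ℤ) → Prop} {i : Fin d → ℤ} :
    (fun j => (i j : ℝ)) ∈ intSet P ↔ P i :=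
  ⟨fun ⟨_, hi, h⟩ => intCast_vec_injective h ▸ hi, fun h => ⟨i, h, rfl⟩⟩

/-- The barycentre formula solved for the index, in the shape (a y + c)/2^n required by
`AutoFun.affine_coord`. -/
theorem eq_barycentre_assocCell_iff {m ℓ : ℕ} {i : Fin d → ℤ} {j : Fin d} {y : ℝ} :
    y = barycentre ℓ (assocCell m i) j ↔
      (((2 ^ (ℓ + 1) : ℤ) : ℝ) * y + ((-1 - 2 * ((m + 1) / 2 : ℕ) : ℤ) : ℝ)) / 2 ^ 1 = i j := by
  rw [barycentre_eq, assocCell, eq_div_iff (by positivity), div_eq_iff (by positivity)]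
  push_cast
  constructor <;> intro h <;> linarith

variable {b L : ℕ} {Ω : Set (Fin d → ℝ)} {M : Set (Fin d → ℤ)}

theorem autoSet_gridCell (hd : 0 < d) (hb : 0 < b) (hb2 : 2 ∣ b)
    (h : FARecognizable {w : Fin d → List (DigitPair b) | ∃ i : Fin d → ℤ, gridCell L i ⊆ Ω ∧
      ∀ j, IsCode b (barycentre L i j) (w j)}) :
    AutoSet b (intSet fun i => gridCell L i ⊆ Ω) := by
  have hb1 : 1 < b := by obtain ⟨k, rfl⟩ := hb2; omega
  have : NeZero b := ⟨hb.ne'⟩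
  have h1 : AutoSet b {z : Fin d → ℝ | ∃ i, gridCell L i ⊆ Ω ∧ z = barycentre L i} := by
    rw [← faRecognizable_codeRel_iff hb1 hd]
    convert h using 1
    ext w
    constructor
    · rintro ⟨_, ⟨i, hi, rfl⟩, hw⟩
      exact ⟨i, hi, hw⟩
    · rintro ⟨i, hi, hw⟩
      exact ⟨_, ⟨i, hi, rfl⟩, hw⟩
  convert h1.comap hb1 fun j => AutoFun.affine_coord hb hb2 j 2 1 (L + 1) using 1
  ext x
  refine exists_congr fun i => and_congr_right fun _ => ?_
  simp only [funext_iff, barycentre_eq]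
  refine forall_congr' fun j => ?_
  rw [div_left_inj' (by positivity)]
  push_cast
  constructor <;> intro h <;> linarith

theorem autoSet_bsplineSupport_same (hb : 0 < b) (hb2 : 2 ∣ b) (m : ℕ)
    (hΩ : Ω = ⋃ i ∈ M, gridCell L i) (h : AutoSet b (intSet fun i => gridCell L i ⊆ Ω)) :
    AutoSet b (intSet fun i => bsplineSupport m L i ⊆ interior Ω) := by
  have hb1 : 1 < b := by obtain ⟨k, rfl⟩ := hb2; omega
  convert AutoSet.iInter fun k : Fin d → Fin (m + 1) => h.comap hb1 fun j =>
    AutoFun.affine_coord hb hb2 j 1 (k j : ℕ) 0 using 1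
  ext x
  rw [Set.mem_iInter]
  constructor
  · rintro ⟨i, hi, rfl⟩ k
    refine ⟨_, (bsplineSupport_subset_interior_iff_same hΩ i).1 hi k, ?_⟩
    simp
  · intro hx
    -- The offset k = 0 already forces `x` to be an integer vector.
    obtain ⟨i, -, hi⟩ := hx 0
    obtain rfl : x = fun j => (i j : ℝ) := funext fun j => by simpa using congrFun hi j
    refine ⟨i, (bsplineSupport_subset_interior_iff_same hΩ i).2 fun k => ?_, rfl⟩
    obtain ⟨i', hi', h'⟩ := hx k
    convert hi' using 2
    apply intCast_vec_injective
    change (fun j => _) = fun j => (i' j : ℝ)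
    rw [← h']
    simp

/-- The parent index ⌊(i + k)/2⌋ is not affine, so the parity vector `r` is guessed and (i + k -
r)/2 used instead; integrality singles out the right `r`. -/
theorem autoSet_bsplineSupport_succ (hb : 0 < b) (hb2 : 2 ∣ b) (m : ℕ)
    (hΩ : Ω = ⋃ i ∈ M, gridCell L i) (h : AutoSet b (intSet fun i => gridCell L i ⊆ Ω)) :
    AutoSet b (intSet fun i => bsplineSupport m (L + 1) i ⊆ interior Ω) := by
  have hb1 : 1 < b := by obtain ⟨k, rfl⟩ := hb2; omega
  convert AutoSet.iInter fun k : Fin d → Fin (m + 1) => AutoSet.iUnion fun r : Fin d → Fin 2 =>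
    h.comap hb1 fun j => AutoFun.affine_coord hb hb2 j 1 ((k j : ℕ) - (r j : ℕ)) 1 using 1
  ext x
  simp only [Set.mem_iInter, Set.mem_iUnion]
  have key : ∀ (i k q r : ℤ), ((1 : ℤ) * (i : ℝ) + ((k - r : ℤ) : ℝ)) / 2 ^ 1 = q ↔
      i + k = 2 * q + r := by
    intro i k q r
    rw [div_eq_iff (by positivity)]
    norm_cast
    omega
  constructor
  · rintro ⟨i, hi, rfl⟩ k
    refine ⟨fun j => ⟨((i j + (k j : ℕ)) % 2).toNat, by omega⟩, _,
      (bsplineSupport_subset_interior_iff_succ hΩ i).1 hi k, funext fun j => ?_⟩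
    rw [key]
    simp only
    omega
  · intro hx
    obtain ⟨r, q, -, hq⟩ := hx 0
    obtain rfl : x = fun j => ((2 * q j + (r j : ℕ) : ℤ) : ℝ) := funext fun j => by
      have := congrFun hq j
      simp only [Fin.val_zero, Pi.zero_apply] at this
      rw [div_eq_iff (by positivity)] at this
      push_cast at this ⊢
      linarith
    refine ⟨_, (bsplineSupport_subset_interior_iff_succ hΩ _).2 fun k => ?_, rfl⟩
    obtain ⟨r', q', hq', h'⟩ := hx k
    convert hq' using 2
    ext j
    have := congrFun h' j
    rw [key] at this
    omega

end IndexSets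

/-! ### The coefficients with respect to the refined mesh -/

section Coefficients

variable {d : ℕ}

open Classical in
/-- The coefficients of the level `L` B-splines whose support is contained in the interior of
`Ω`. -/
def removedCoeff (m L : ℕ) (Ω : Set (Fin d → ℝ)) (c : ℕ × (Fin d → ℤ) → ℝ) (i : Fin d → ℤ) : ℝ :=
  if bsplineSupport m L i ⊆ interior Ω then c (L, i) else 0

/-- The coefficients after knot insertion. -/
def refinedCoeff (m : ℕ) (a : (Fin d → ℤ) → ℝ) (n : Fin d → ℤ) : ℝ :=
  ∑ k : Fin d → Fin (m + 2), (∏ j, ((m + 1).choose (k j) : ℝ) / 2 ^ m) *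
    Function.extend (fun (i : Fin d → ℤ) j => 2 * i j + (k j : ℕ)) a 0 n

/-- The coefficients with respect to the refined mesh. -/
def newCoeff (m L : ℕ) (Ω : Set (Fin d → ℝ)) (c : ℕ × (Fin d → ℤ) → ℝ) (p : ℕ × (Fin d → ℤ)) : ℝ :=
  if p.1 = L + 1 then refinedCoeff m (removedCoeff m L Ω c) p.2 else c p

theorem two_mul_add_injective {K : Type*} (k : Fin d → K) (v : K → ℤ) :
    Function.Injective fun (i : Fin d → ℤ) j => 2 * i j + v (k j) := fun i i' h =>
  funext fun j => by
    have := congrFun h j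
    simp only at this
    omega

/-- A fine B-spline occurring in a removed one has smaller support. Hence knot insertion produces
only B-splines selected for `T'`. -/
theorem refinedCoeff_removedCoeff_eq_zero {m L : ℕ} {Ω : Set (Fin d → ℝ)}
    {c : ℕ × (Fin d → ℤ) → ℝ} {i' : Fin d → ℤ}
    (h : ¬ bsplineSupport m (L + 1) i' ⊆ interior Ω) :
    refinedCoeff m (removedCoeff m L Ω c) i' = 0 := by
  refine Finset.sum_eq_zero fun k _ => mul_eq_zero_of_right _ ?_
  by_cases hi : ∃ i : Fin d → ℤ, (fun j => 2 * i j + ((k j : ℕ) : ℤ)) = i'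
  · obtain ⟨i, rfl⟩ := hi
    rw [(two_mul_add_injective k fun n => ((n : ℕ) : ℤ)).extend_apply, removedCoeff, if_neg]
    exact fun h' => h ((bsplineSupport_succ_subset i k).trans h')
  · exact Function.extend_apply' _ _ _ hi

/-- The function on real vectors that extends the given coefficients by zero. -/
def coeffFun (a : (Fin d → ℤ) → ℝ) : (Fin d → ℝ) → ℝ :=
  Function.extend (fun (i : Fin d → ℤ) (j : Fin d) => (i j : ℝ)) a 0

theorem coeffFun_intCast (a : (Fin d → ℤ) → ℝ) (i : Fin d → ℤ) :
    coeffFun a (fun j => (i j : ℝ)) = a i :=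
  intCast_vec_injective.extend_apply _ _ _

theorem coeffFun_mem {a : (Fin d → ℤ) → ℝ} {s : Set ℝ} (h0 : 0 ∈ s) (ha : ∀ i, a i ∈ s)
    (x : Fin d → ℝ) : coeffFun a x ∈ s := by
  by_cases h : ∃ i : Fin d → ℤ, (fun j => (i j : ℝ)) = x
  · obtain ⟨i, rfl⟩ := h
    rw [coeffFun_intCast]
    exact ha i
  · rw [coeffFun, Function.extend_apply' _ _ _ h]
    exact h0

/-- Brings the coefficient into the form handled by `AutoFun.affine_comp`. No parity test is needed:
if (n - k)/2 is not an integer vector, `coeffFun` vanishes there. -/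
theorem refinedCoeff_eq (m : ℕ) (a : (Fin d → ℤ) → ℝ) (i' : Fin d → ℤ) :
    refinedCoeff m a i' = (∑ k : Fin d → Fin (m + 2), ((∏ j, (m + 1).choose (k j) : ℕ) : ℤ) *
      coeffFun a (fun j => ((1 : ℤ) * (i' j : ℝ) + ((-(k j : ℕ) : ℤ) : ℝ)) / 2 ^ 1) + (0 : ℤ)) /
        2 ^ (m * d) := by
  rw [Int.cast_zero, add_zero, Finset.sum_div]
  refine Finset.sum_congr rfl fun k _ => ?_
  rw [Finset.prod_div_distrib, Finset.prod_const, Finset.card_univ, Fintype.card_fin, ← pow_mul,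
    div_mul_eq_mul_div]
  congr 2
  · push_cast; rfl
  by_cases hi : ∃ i : Fin d → ℤ, (fun j => 2 * i j + ((k j : ℕ) : ℤ)) = i'
  · obtain ⟨i, rfl⟩ := hi
    rw [(two_mul_add_injective k fun n => ((n : ℕ) : ℤ)).extend_apply, ← coeffFun_intCast a i]
    congr 1
    ext j
    push_cast
    ring
  · rw [Function.extend_apply' _ _ _ hi, coeffFun, Function.extend_apply']
    · rfl
    · rintro ⟨i, h⟩
      refine hi ⟨i, funext fun j => ?_⟩
      have := congrFun h j
      rw [eq_div_iff (by positivity)] at this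
      have h2 : i j * 2 ^ 1 = 1 * i' j + -((k j : ℕ) : ℤ) := by exact_mod_cast this
      omega

end Coefficients

/-! ### Automaticity and correctness of the new coefficients -/

namespace HierarchicalMesh

variable {d : ℕ}

/-- The set of pairs formed by the barycentre of `c_β` and the coefficient of `β`, for `β ∈ K`. -/
def coeffSet (T : HierarchicalMesh d) (m : ℕ) (c : ℕ × (Fin d → ℤ) → ℝ) : Set (Fin (d + 1) → ℝ) :=
  {z | ∃ p ∈ T.kraft m, (∀ j : Fin d, z j.castSucc = barycentre p.1 (assocCell m p.2) j) ∧
    z (Fin.last d) = c p}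

theorem coeffRel_eq_codeRel (T : HierarchicalMesh d) (b m : ℕ) (c : ℕ × (Fin d → ℤ) → ℝ) :
    T.coeffRel b m (fun p => c p.1) = codeRel b (T.coeffSet m c) := by
  ext w
  constructor
  · rintro ⟨p, hp, hp'⟩
    refine ⟨Fin.lastCases (c p.1) (barycentre p.1.1 (assocCell m p.1.2)), ⟨p.1, p.2, ?_, ?_⟩, ?_⟩
    · simp
    · simp
    · rw [Fin.forall_fin_succ']
      simpa using ⟨hp, hp'⟩
  · rintro ⟨z, ⟨p, hp, hz, hz'⟩, hw⟩
    refine ⟨⟨p, hp⟩, fun j => ?_, ?_⟩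
    · rw [← hz]; exact hw _
    · change IsCode b (c p) _
      rw [← hz']; exact hw _

variable {T T' : HierarchicalMesh d} {b m L : ℕ}

/-- The index of the level `ℓ` B-spline `β` as a function of the barycentre of `c_β`. -/
def barycentreIndex {d : ℕ} (m ℓ : ℕ) (z : Fin (d + 1) → ℝ) : Fin d → ℝ := fun j =>
  (((2 ^ (ℓ + 1) : ℤ) : ℝ) * z j.castSucc + ((-1 - 2 * ((m + 1) / 2 : ℕ) : ℤ) : ℝ)) / 2 ^ 1

theorem barycentreIndex_eq_iff {ℓ : ℕ} {z : Fin (d + 1) → ℝ} {i : Fin d → ℤ} :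
    (barycentreIndex m ℓ z = fun j => (i j : ℝ)) ↔
      ∀ j : Fin d, z j.castSucc = barycentre ℓ (assocCell m i) j := by
  simp only [eq_barycentre_assocCell_iff, funext_iff, barycentreIndex]

/-- The graph is defined by cases: either the support lies in Ω^{L+1} and the pair (barycentre,
value) belongs to the old coefficient set, or it does not and the value is 0. As barycentres
determine the level, no other level interferes. -/
theorem autoFun_removedCoeff (hd : 0 < d) (hb : 0 < b) (hb2 : 2 ∣ b) (hL : T.N = L + 1)
    (href : T'.IsRefinementOf T) {c : ℕ × (Fin d → ℤ) → ℝ} (hc : ∀ p, c p ∈ zInv b)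
    (hcoeff : AutoSet b (T.coeffSet m c))
    (hsupp : AutoSet b (intSet fun i => bsplineSupport m L i ⊆ interior (T'.Ω (L + 1)))) :
    AutoFun b (coeffFun (removedCoeff m L (T'.Ω (L + 1)) c)) := by
  have hb1 : 1 < b := by obtain ⟨k, rfl⟩ := hb2; omega
  have h0 : (0 : ℝ) ∈ zInv b := by simpa using intCast_mem_zInv (b := b) 0
  refine ⟨fun z _ => coeffFun_mem h0 (fun i => ?_) z, ?_⟩
  · rw [removedCoeff]
    split_ifs
    exacts [hc _, h0]
  let φ : Fin (d + 1) → (Fin d ⊕ Unit → ℝ) → ℝ := Fin.lastCases (fun p => p (Sum.inr ()))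
    fun j p => ((2 : ℤ) * p (Sum.inl j) + ((2 * ((m + 1) / 2 : ℕ) + 1 : ℤ) : ℝ)) / 2 ^ (L + 1)
  have hφ : ∀ j, AutoFun b (φ j) := by
    refine Fin.lastCases ?_ fun j => ?_
    · simpa [φ] using AutoFun.coord hb _
    · simpa only [φ, Fin.lastCases_castSucc] using AutoFun.affine_coord hb hb2 _ _ _ _
  have h1 := (hsupp.comap_coord (Sum.inl : Fin d → Fin d ⊕ Unit)).inter (hcoeff.comap hb1 hφ)
  have h2 := (hsupp.comap_coord (Sum.inl : Fin d → Fin d ⊕ Unit)).compl.inter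
    (AutoSet.linear hb (Sum.elim (fun _ => 0) fun _ => 1 : Fin d ⊕ Unit → ℤ) 0)
  convert h1.union h2 using 1
  ext p
  have hlin : ∑ v, ((Sum.elim (fun _ => 0) fun _ => 1 : Fin d ⊕ Unit → ℤ) v : ℝ) * p v =
      p (Sum.inr ()) := by simp [Fintype.sum_sum_type]
  set A := intSet fun i => bsplineSupport m L i ⊆ interior (T'.Ω (L + 1)) with hA
  change p (Sum.inr ()) = coeffFun _ (p ∘ Sum.inl) ↔
    (p ∘ Sum.inl ∈ A ∧ (fun v => φ v p) ∈ T.coeffSet m c) ∨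
    (p ∘ Sum.inl ∉ A ∧ ∑ v, _ * p v = ((0 : ℤ) : ℝ))
  rw [hlin, Int.cast_zero]
  by_cases hp : p ∘ Sum.inl ∈ A
  · simp only [hp, true_and, not_true, false_and, or_false]
    obtain ⟨i, hi, hpi⟩ := hp
    have hpi' : ∀ j, p (Sum.inl j) = i j := fun j => congrFun hpi j
    rw [hpi, coeffFun_intCast, removedCoeff, if_pos hi]
    have hz : ∀ j : Fin d, φ j.castSucc p = barycentre L (assocCell m i) j := by
      intro j
      simp only [φ, Fin.lastCases_castSucc, hpi', barycentre_eq, assocCell]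
      push_cast
      ring
    have hz' : φ (Fin.last d) p = p (Sum.inr ()) := by simp [φ]
    constructor
    · intro h
      exact ⟨(L, i), href.mem_kraft_of_subset hL hi, hz, hz'.trans h⟩
    · rintro ⟨⟨ℓ, i'⟩, -, h3, h4⟩
      obtain ⟨rfl, h5⟩ := barycentre_injective hd fun j => (hz j).symm.trans (h3 j)
      obtain rfl : i = i' := funext fun j => by
        have := congrFun h5 j
        simpa [assocCell] using this
      exact hz'.symm.trans h4
  · simp only [hp, false_and, not_false_eq_true, true_and, false_or]
    have : coeffFun (removedCoeff m L (T'.Ω (L + 1)) c) (p ∘ Sum.inl) = 0 := by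
      by_cases h : ∃ i : Fin d → ℤ, (fun j => (i j : ℝ)) = p ∘ Sum.inl
      · obtain ⟨i, hi⟩ := h
        rw [← hi, coeffFun_intCast, removedCoeff, if_neg]
        rwa [← hi, hA, intCast_mem_intSet] at hp
      · rw [coeffFun, Function.extend_apply' _ _ _ h]
        rfl
    rw [this]

theorem autoSet_coeffSet_newCoeff (hd : 0 < d) (hb : 0 < b) (hb2 : 2 ∣ b) (hL : T.N = L + 1)
    (href : T'.IsRefinementOf T) {c : ℕ × (Fin d → ℤ) → ℝ} (hc : ∀ p, c p ∈ zInv b)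
    (hcoeff : AutoSet b (T.coeffSet m c))
    (hcell : AutoSet b (intSet fun i => gridCell L i ⊆ T'.Ω (L + 1))) :
    AutoSet b (T'.coeffSet m (newCoeff m L (T'.Ω (L + 1)) c)) := by
  have hb1 : 1 < b := by obtain ⟨k, rfl⟩ := hb2; omega
  obtain ⟨M, hM⟩ := T'.Ω_succ_eq_iUnion L
  have hA := autoSet_bsplineSupport_same hb hb2 m hM hcell
  have hB := autoSet_bsplineSupport_succ hb hb2 m hM hcell
  have ha := autoFun_removedCoeff hd hb hb2 hL href hc hcoeff hA
  set a := removedCoeff m L (T'.Ω (L + 1)) c with ha_def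
  have hidx : ∀ ℓ, ∀ j : Fin d, AutoFun b fun z : Fin (d + 1) → ℝ => barycentreIndex m ℓ z j :=
    fun ℓ j => AutoFun.affine_coord hb hb2 j.castSucc _ _ 1
  have ha' : AutoFun b fun x : Fin d → ℝ => (∑ k : Fin d → Fin (m + 2),
      ((∏ j, (m + 1).choose (k j) : ℕ) : ℤ) * coeffFun a (fun j => ((1 : ℤ) * x j +
        ((-(k j : ℕ) : ℤ) : ℝ)) / 2 ^ 1) + (0 : ℤ)) / 2 ^ (m * d) :=
    AutoFun.affine_comp hb hb2 _ 0 _ fun k => ha.comp hb1 fun j =>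
      AutoFun.affine_coord hb hb2 j _ _ 1
  -- `h1` describes the old pairs that are kept, `h2` the level `L + 1` pairs with coefficients
  -- given by knot insertion.
  have h1 := hcoeff.inter (hA.comap hb1 (hidx L)).compl
  have h2 := (hB.comap hb1 (hidx (L + 1))).inter
    (((ha'.comp hb1 (hidx (L + 1))).graph_coord id (Fin.last d)))
  convert h1.union h2 using 1
  ext z
  change z ∈ T'.coeffSet m _ ↔ (z ∈ T.coeffSet m c ∧ barycentreIndex m L z ∉ intSet _) ∨
    (barycentreIndex m (L + 1) z ∈ intSet _ ∧ z (Fin.last d) = _)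
  have hnot : ∀ p ∈ T.kraft m, p.1 ≠ L + 1 := fun p hp h => by
    have := hp.1
    omega
  constructor
  · rintro ⟨p, hp, hz, hz'⟩
    rcases (href.mem_kraft_iff hL).1 hp with ⟨hpT, hp2⟩ | ⟨hpL, hp2⟩
    · rw [newCoeff, if_neg (hnot p hpT)] at hz'
      refine .inl ⟨⟨p, hpT, hz, hz'⟩, ?_⟩
      rintro ⟨i, hi, hi'⟩
      rw [barycentreIndex_eq_iff] at hi'
      obtain ⟨h3, h4⟩ := barycentre_injective hd fun j => (hz j).symm.trans (hi' j)
      refine hp2 ⟨h3, ?_⟩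
      convert hi using 1
      congr 1
      ext j
      simpa [assocCell] using congrFun h4 j
    · rw [newCoeff, if_pos hpL, refinedCoeff_eq] at hz'
      rw [hpL, ← barycentreIndex_eq_iff] at hz
      refine .inr ⟨⟨p.2, hp2, hz⟩, ?_⟩
      rw [hz', show z ∘ id = z from rfl, hz]
  · rintro (⟨⟨p, hp, hz, hz'⟩, h3⟩ | ⟨⟨i, hi, hz⟩, hz'⟩)
    · refine ⟨p, (href.mem_kraft_iff hL).2 (.inl ⟨hp, ?_⟩), hz, ?_⟩
      · rintro ⟨rfl, h4⟩
        exact h3 ⟨p.2, h4, barycentreIndex_eq_iff.2 hz⟩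
      · rw [newCoeff, if_neg (hnot p hp), hz']
    · refine ⟨(L + 1, i), (href.mem_kraft_iff hL).2 (.inr ⟨rfl, hi⟩),
        barycentreIndex_eq_iff.1 hz, ?_⟩
      rw [hz', newCoeff, if_pos rfl, refinedCoeff_eq, show z ∘ id = z from rfl, hz]

theorem hasSum_newCoeff (hL : T.N = L + 1) (href : T'.IsRefinementOf T)
    {c : ℕ × (Fin d → ℤ) → ℝ} {x : Fin d → ℝ} {S : ℝ}
    (h : HasSum (fun p : T.kraft m => c p.1 * tensorBspline m p.1.1 p.1.2 x) S) :
    HasSum (fun p : T'.kraft m => newCoeff m L (T'.Ω (L + 1)) c p.1 *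
      tensorBspline m p.1.1 p.1.2 x) S := by
  classical
  set a := removedCoeff m L (T'.Ω (L + 1)) c with ha_def
  have hinj : ∀ ℓ : ℕ, Function.Injective fun i : Fin d → ℤ => (ℓ, i) :=
    fun ℓ i i' h => (Prod.ext_iff.1 h).2
  have hlevel : ∀ (ℓ : ℕ) (g : (Fin d → ℤ) → ℝ) (s : ℝ), HasSum g s →
      HasSum (fun p : ℕ × (Fin d → ℤ) => if p.1 = ℓ then g p.2 else 0) s := by
    intro ℓ g s hg
    refine ((hinj ℓ).hasSum_iff ?_).1 (hg.congr_fun fun i => by simp)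
    rintro ⟨ℓ', i⟩ hp
    refine if_neg fun h => hp ⟨i, ?_⟩
    simp_all
  have hs : Summable fun i => a i * tensorBspline m L i x :=
    summable_of_hasFiniteSupport ((finite_tensorBspline_ne_zero m L x).subset
      fun i hi => right_ne_zero_of_mul hi)
  have h1 := hlevel L _ _ hs.hasSum
  have h2 := hlevel (L + 1) _ _ (hasSum_tensorBspline_succ m L x hs.hasSum)
  have h0 := (hasSum_subtype_iff_indicator (s := T.kraft m)
    (f := fun p => c p * tensorBspline m p.1 p.2 x)).1 h
  refine (hasSum_subtype_iff_indicator (s := T'.kraft m)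
    (f := fun p => newCoeff m L (T'.Ω (L + 1)) c p * tensorBspline m p.1 p.2 x)).2 ?_
  -- With all families extended by zero to every (ℓ, i), the new one is the old one minus the
  -- removed part plus its refinement, and these last two have equal sums.
  have h3 := (h0.sub h1).add h2
  rw [sub_add_cancel] at h3
  refine h3.congr_fun fun p => ?_
  obtain ⟨ℓ, i⟩ := p
  rw [Set.indicator_apply, Set.indicator_apply, href.mem_kraft_iff hL]
  simp only
  by_cases hℓ : ℓ = L + 1
  · subst hℓ
    have hT : (L + 1, i) ∉ T.kraft m := fun hp => by have := hp.1; simp only at this; omega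
    simp only [hT, false_and, false_or, true_and, if_false, if_true, newCoeff]
    rw [if_neg (show ¬ L + 1 = L by omega), sub_zero, zero_add]
    change _ = refinedCoeff m a i * _
    split_ifs with hsup
    · rfl
    · rw [refinedCoeff_removedCoeff_eq_zero hsup, zero_mul]
  · simp only [hℓ, false_and, or_false, if_false, add_zero, newCoeff]
    by_cases hℓ' : ℓ = L
    · subst hℓ'
      simp only [true_and, if_true, ha_def, removedCoeff]
      by_cases hsup : bsplineSupport m ℓ i ⊆ interior (T'.Ω (ℓ + 1))
      · simp [hsup, href.mem_kraft_of_subset hL hsup]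
      · simp [hsup]
    · simp [hℓ']

theorem newCoeff_mem_zInv (hb : 0 < b) (hb2 : 2 ∣ b) {Ω : Set (Fin d → ℝ)}
    {c : ℕ × (Fin d → ℤ) → ℝ} (hc : ∀ p, c p ∈ zInv b) (p : ℕ × (Fin d → ℤ)) :
    newCoeff m L Ω c p ∈ zInv b := by
  have h0 : (0 : ℝ) ∈ zInv b := by simpa using intCast_mem_zInv (b := b) 0
  rw [newCoeff]
  split_ifs
  · rw [refinedCoeff_eq]
    refine div_two_pow_mem_zInv hb hb2 (zInv_add hb (zInv_sum hb _ fun k _ =>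
      zInv_mul (intCast_mem_zInv _) (coeffFun_mem h0 (fun i => ?_) _)) (intCast_mem_zInv _)) _
    rw [removedCoeff]
    split_ifs
    exacts [hc _, h0]
  · exact hc p

end HierarchicalMesh

end

/-! ### The theorem -/

theorem theorem8 (d : ℕ) (hd : 0 < d) (b : ℕ) (hb : 0 < b) (hb2 : 2 ∣ b) (m : ℕ)
    (T T' : HierarchicalMesh d) (hT : T.IsRegular b) (hT' : T'.IsRegular b)
    (href : T'.IsRefinementOf T) (f : (Fin d → ℝ) → ℝ) (hf : T.IsRegularSpline b m f) :
    T'.IsRegularSpline b m f := by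
  have hb1 : 1 < b := by obtain ⟨k, rfl⟩ := hb2; omega
  have : NeZero b := ⟨hb.ne'⟩
  obtain ⟨L, hL⟩ : ∃ L, T.N = L + 1 := ⟨T.N - 1, by have := T.N_pos; omega⟩
  obtain ⟨hfS, c₀, hsum, hc₀, hrec⟩ := hf
  -- Extending the coefficients by zero beyond 𝒦 lets the old and new families share one index type.
  obtain ⟨c, hc, rfl⟩ : ∃ c : ℕ × (Fin d → ℤ) → ℝ, (∀ p, c p ∈ zInv b) ∧
      c₀ = fun p => c p.1 := by
    classical
    refine ⟨fun p => if h : p ∈ T.kraft m then c₀ ⟨p, h⟩ else 0, fun p => ?_, ?_⟩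
    · beta_reduce
      split_ifs
      · exact hc₀ _
      · simpa using intCast_mem_zInv (b := b) 0
    · ext p
      simp
  rw [HierarchicalMesh.coeffRel_eq_codeRel, faRecognizable_codeRel_iff hb1 d.succ_pos] at hrec
  refine ⟨href.splineSpace_subset m hfS, fun p => newCoeff m L (T'.Ω (L + 1)) c p.1,
    fun x => HierarchicalMesh.hasSum_newCoeff hL href (hsum x),
    fun p => HierarchicalMesh.newCoeff_mem_zInv hb hb2 hc p.1, ?_⟩
  rw [HierarchicalMesh.coeffRel_eq_codeRel, faRecognizable_codeRel_iff hb1 d.succ_pos]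
  refine HierarchicalMesh.autoSet_coeffSet_newCoeff hd hb hb2 hL href hc hrec
    (autoSet_gridCell hd hb hb2 ?_)
  exact hT' (L + 1) (by omega) (by have := href.1; omega)
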